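/- Let $(X,g)$ be an admissible Riemannian polyhedron of dimension $m$. That is, $X$ is a connected, locally compact, separable metric space with a locally bi-Lipschitz triangulation $\theta:K\to X$, where $K$ is a locally finite simplicial complex in a Euclidean space in which every simplex is a face of an $m$-simplex, and such that for every connected open set $U\subset X$ the set $U\setminus\{(m-2)\text{-skeleton}\}$ is connected. Moreover, every open $m$-simplex $\Delta^\circ$ carries, in Euclidean coordinates, a measurable Riemannian metric $g=(g_{ij})$ with $\Lambda_\Delta^{-2}|\xi|^2\le \sum_{i,j} g_{ij}(x)\xi^i\xi^j\le\Lambda_\Delta^2|\xi|^2$ for a.e. $x$ and all $\xi\in\mathbb R^m$, for some constant $\Lambda_\Delta>0$. "Almost everywhere" means up to a set that meets each $m$-simplex in a Lebesgue null set, $\mu_g$ is the volume measure $\sqrt{\det g}\,dx$, and $d_X$ is the intrinsic distance: $d_X(x,y)$ is the supremum, over all null sets $Z$, of the infimum of the $g$-lengths of the Lipschitz paths from $x$ to $y$ that spend only a null set of times in $Z$. The gradient $\nabla$ of a function on an open subset of $X$ is the weak gradient on the open $m$-simplexes, so that $\langle\nabla u,\nabla w\rangle=\sum_{i,j} g^{ij}\,\partial_i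 u\,\partial_j w$ a.e. Let $(N,J^N,g_N)$ be a Hermitian manifold: a (Hausdorff, second countable) complex manifold without boundary, with complex structure $J^N$, and with a smooth Riemannian metric $g_N$ such that $g_N(J^N\xi,J^N\eta)=g_N(\xi,\eta)$. Let $d_N$ be its Riemannian distance. A map $\varphi:X\to N$ is of class $W^{1,2}_{loc}(X,N)$ if it is $\mu_g$-measurable with separable essential range, $d_N(\varphi(\cdot),q)\in L^2_{loc}(X,\mu_g)$ for some $q\in N$, and for every relatively compact domain $U\subset X$ $$E(\varphi_{|U})=\sup_{f\in C_c(U,[0,1])}\ \limsup_{\epsilon\to0}\int_U f(x)\int_{\{x'\in U:\,d_X(x,x')<\epsilon\}}\frac{d_N^2(\varphi(x),\varphi(x'))}{\epsilon^{m+2}}\,d\mu_g(x')\,d\mu_g(x)<\infty .$$ A continuous map $\varphi:X\to N$ of class $W^{1,2}_{loc}(X,N)$ is called * *horizontally weakly conformal* if there is a scalar function $\lambda$ on $X$ such that for all real functions $v,w\in C^1(N)$ $$\langle\nabla(v\circ\varphi),\nabla(w\circ\varphi)\rangle=\lambda\,\big[g_N(\nabla_Nv,\nabla_Nw)\circ\varphi\big]\quad\text{a.e.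 in }X;$$ * *pseudo-horizontally weakly conformal* if for every open set $U\subset N$ and all holomorphic functions $v=v_1+iv_2$ and $w=w_1+iw_2$ on $U$ $$\langle\nabla(w_1\circ\varphi),\nabla(v_1\circ\varphi)\rangle-\langle\nabla(w_2\circ\varphi),\nabla(v_2\circ\varphi)\rangle=0,\qquad \langle\nabla(w_2\circ\varphi),\nabla(v_1\circ\varphi)\rangle+\langle\nabla(w_1\circ\varphi),\nabla(v_2\circ\varphi)\rangle=0$$ a.e. in $\varphi^{-1}(U)$. (In both cases the gradients exist because $\varphi$ is continuous and of class $W^{1,2}_{loc}$.) **Proposition.** Let $\varphi:X\to N$ be a map from an admissible Riemannian polyhedron into a Hermitian manifold. If $\varphi$ is horizontally weakly conformal, then $\varphi$ is pseudo-horizontally weakly conformal. If $\dim_{\mathbb C}N=1$, then $\varphi$ is horizontally weakly conformal if and only if it is pseudo-horizontally weakly conformal. -/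

import Mathlib

open Bundle Manifold MeasureTheory Filter Topology Set
open scoped ContDiff ENNReal NNReal Matrix

noncomputable section

/-! ### Riemannian polyhedra -/

/-- A Lip triangulation, of homogeneous dimension `m`, of a metric space `X`: a locally finite
simplicial complex `K` affinely embedded in some Euclidean space, together with a locally
bi-Lipschitz homeomorphism `θ : |K| → X`. Every `m`-simplex comes with a Euclidean frame, that is,
with an isometric affine parametrization of its affine span by `ℝᵐ`. -/
structure LipTriangulation (X : Type*) [MetricSpace X] (m : ℕ) where
  /-- the dimension of the ambient Euclidean space -/
  ambientDim : ℕ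
  /-- the simplicial complex -/
  K : Geometry.SimplicialComplex ℝ (EuclideanSpace ℝ (Fin ambientDim))
  locallyFinite : ∀ p ∈ K.space, ∃ W ∈ 𝓝 p,
    {s | s ∈ K.faces ∧ (convexHull ℝ (s : Set (EuclideanSpace ℝ (Fin ambientDim))) ∩ W).Nonempty}.Finite
  /-- dimensional homogeneity: every simplex is a face of an `m`-simplex -/
  homogeneous : ∀ s ∈ K.faces, ∃ t ∈ K.faces, s ⊆ t ∧ t.card = m + 1
  /-- the homeomorphism from the geometric realization to `X` -/
  θ : K.space ≃ₜ X
  biLipschitz : ∀ x : X, ∃ W ∈ 𝓝 x, ∃ C : ℝ≥0, ∀ y ∈ W, ∀ z ∈ W,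
    dist (θ.symm y) (θ.symm z) ≤ C * dist y z ∧ dist y z ≤ C * dist (θ.symm y) (θ.symm z)
  /-- the Euclidean frames on the `m`-simplexes -/
  frame : {s // s ∈ K.faces ∧ s.card = m + 1} →
    (EuclideanSpace ℝ (Fin m) →ᵃⁱ[ℝ] EuclideanSpace ℝ (Fin ambientDim))
  range_frame : ∀ Δ, Set.range (frame Δ) =
    (affineSpan ℝ (Δ.1 : Set (EuclideanSpace ℝ (Fin ambientDim))) :
      Set (EuclideanSpace ℝ (Fin ambientDim)))

namespace LipTriangulation

variable {X : Type*} [MetricSpace X] {m : ℕ} (T : LipTriangulation X m)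

/-- The top-dimensional simplexes; by homogeneity these are the maximal ones. -/
abbrev Cell : Type := {s // s ∈ T.K.faces ∧ s.card = m + 1}

/-- The open simplex `θ⁻¹(Δ°)`, in the Euclidean coordinates `x₁, …, xₘ` of its frame. -/
def openCell (Δ : T.Cell) : Set (EuclideanSpace ℝ (Fin m)) :=
  interior (T.frame Δ ⁻¹' convexHull ℝ (Δ.1 : Set (EuclideanSpace ℝ (Fin T.ambientDim))))

open Classical in
/-- The point of `X` with Euclidean coordinates `s` in the simplex `Δ` (a junk value if `s` does
not lie in the complex; only used for `s ∈ T.openCell Δ`). -/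
def point [Nonempty X] (Δ : T.Cell) (s : EuclideanSpace ℝ (Fin m)) : X :=
  if h : T.frame Δ s ∈ T.K.space then T.θ ⟨T.frame Δ s, h⟩ else Classical.arbitrary X

/-- The Euclidean coordinates, in the frame of `Δ`, of a point `x` of `X`: the inverse of
`T.point Δ` on the simplex `Δ` (outside of `Δ`, the coordinates of the orthogonal projection). -/
def coord (Δ : T.Cell) (x : X) : EuclideanSpace ℝ (Fin m) :=
  ContinuousLinearMap.adjoint (T.frame Δ).linearIsometry.toContinuousLinearMap
    ((T.θ.symm x : EuclideanSpace ℝ (Fin T.ambientDim)) - T.frame Δ 0)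

/-- The `(m - 2)`-skeleton, in `X`: the union of the simplexes with at most `m - 1` vertices. -/
def codimTwoSkeleton : Set X :=
  {x | ∃ s ∈ T.K.faces, s.card + 1 ≤ m ∧
    (T.θ.symm x : EuclideanSpace ℝ (Fin T.ambientDim)) ∈
      convexHull ℝ (s : Set (EuclideanSpace ℝ (Fin T.ambientDim)))}

/-- Admissibility. Dimensional homogeneity is already part of `LipTriangulation`; the other
condition is that connected open sets are not disconnected by the `(m - 2)`-skeleton. -/
def IsAdmissible : Prop :=
  ∀ U : Set X, IsOpen U → IsConnected U → IsConnected (U \ T.codimTwoSkeleton)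

/-- `P` holds almost everywhere in `X`, i.e. outside of a set that meets every maximal simplex in a
set of `m`-dimensional Lebesgue measure zero. -/
def AlmostEverywhere [Nonempty X] (P : T.Cell → EuclideanSpace ℝ (Fin m) → Prop) : Prop :=
  ∀ Δ : T.Cell, ∀ᵐ s ∂(volume.restrict (T.openCell Δ)), P Δ s

/-- Null sets. -/
def IsNull [Nonempty X] (Z : Set X) : Prop :=
  T.AlmostEverywhere fun Δ s => T.point Δ s ∉ Z

/-- `G` is the family of weak partial derivatives `(∂₁ f, …, ∂ₘ f)` of the function `f` on the open
set `Ω` of `X`, in the Euclidean coordinates of each open maximal simplex. These are the covariant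
components of the gradient of `f`; see `RiemannianPolyhedron.gradInner`. -/
def IsWeakGradient [Nonempty X] (f : X → ℝ) (Ω : Set X)
    (G : T.Cell → EuclideanSpace ℝ (Fin m) → EuclideanSpace ℝ (Fin m)) : Prop :=
  ∀ Δ : T.Cell,
    LocallyIntegrableOn (fun s => f (T.point Δ s)) (T.openCell Δ ∩ T.point Δ ⁻¹' Ω) ∧
    LocallyIntegrableOn (G Δ) (T.openCell Δ ∩ T.point Δ ⁻¹' Ω) ∧
    ∀ ψ : EuclideanSpace ℝ (Fin m) → ℝ, ContDiff ℝ ∞ ψ → HasCompactSupport ψ →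
      tsupport ψ ⊆ T.openCell Δ ∩ T.point Δ ⁻¹' Ω → ∀ i : Fin m,
        ∫ s, f (T.point Δ s) * fderiv ℝ ψ s (EuclideanSpace.single i 1) = - ∫ s, G Δ s i * ψ s

end LipTriangulation

/-- A Riemannian polyhedron of homogeneous dimension `m`: a Lip polyhedron with a specified
triangulation and, on each open maximal simplex, a measurable Riemannian metric `g`, given by its
matrix in Euclidean coordinates and satisfying the ellipticity condition. -/
structure RiemannianPolyhedron (X : Type*) [MetricSpace X] (m : ℕ) extends LipTriangulation X m where
  /-- the matrix `(g_ij)` of the metric on a maximal simplex -/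
  g : toLipTriangulation.Cell → EuclideanSpace ℝ (Fin m) → Matrix (Fin m) (Fin m) ℝ
  measurable_g : ∀ Δ i j,
    AEMeasurable (fun s => g Δ s i j) (volume.restrict (toLipTriangulation.openCell Δ))
  posDef_g : ∀ Δ, ∀ᵐ s ∂(volume.restrict (toLipTriangulation.openCell Δ)), (g Δ s).PosDef
  elliptic : ∀ Δ, ∃ Λ : ℝ, 0 < Λ ∧
    ∀ᵐ s ∂(volume.restrict (toLipTriangulation.openCell Δ)), ∀ ξ : Fin m → ℝ,
      (Λ ^ 2)⁻¹ * (ξ ⬝ᵥ ξ) ≤ ξ ⬝ᵥ (g Δ s *ᵥ ξ) ∧ ξ ⬝ᵥ (g Δ s *ᵥ ξ) ≤ Λ ^ 2 * (ξ ⬝ᵥ ξ)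

namespace RiemannianPolyhedron

variable {X : Type*} [MetricSpace X] {m : ℕ} (P : RiemannianPolyhedron X m)

/-- The inner product `⟨∇u, ∇w⟩ = ∑ g^{ij} ∂ᵢu ∂ⱼw` of two gradients, computed from the partial
derivatives `a = (∂ᵢu)` and `b = (∂ⱼw)` at the point with coordinates `s` of the simplex `Δ`;
`(g^{ij})` is the inverse of the matrix `(g_ij)`. -/
def gradInner (Δ : P.Cell) (s a b : EuclideanSpace ℝ (Fin m)) : ℝ :=
  ∑ i, ∑ j, (P.g Δ s)⁻¹ i j * a i * b j

/-- The volume measure `μ_g`: on each open maximal simplex it has the density `√(det g)` with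
respect to Lebesgue measure, and the lower-dimensional skeleton is a null set. -/
def vol [Nonempty X] [MeasurableSpace X] : Measure X :=
  Measure.sum fun Δ : P.Cell =>
    ((volume.restrict (P.openCell Δ)).withDensity
      fun s => ENNReal.ofReal √(P.g Δ s).det).map (P.point Δ)

/-- The length of a Lipschitz path `γ : [0, 1] → X`: the sum over the maximal simplexes of the
integrals of `√(g_ij γ̇ⁱ γ̇ʲ)` over the times that `γ` spends in the open simplex. -/
def pathLength [Nonempty X] (γ : ℝ → X) : ℝ≥0∞ :=
  ∑' Δ : P.Cell, ∫⁻ t in Icc (0 : ℝ) 1 ∩ γ ⁻¹' (P.point Δ '' P.openCell Δ),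
    ENNReal.ofReal √((deriv (fun r => P.coord Δ (γ r)) t).ofLp ⬝ᵥ
      (P.g Δ (P.coord Δ (γ t)) *ᵥ (deriv (fun r => P.coord Δ (γ r)) t).ofLp))

/-- The intrinsic distance `d_X`: the supremum, over the null sets `Z`, of the infimum of the
lengths of the Lipschitz paths from `x` to `y` that are transversal to `Z` (i.e. that spend
only a null set of times in `Z`). The infimum increases with `Z`, so that it makes no difference
if `Z` is asked to contain a given null set, such as the union of the lower-dimensional skeleton
and of the points that are not Lebesgue points of the metric. -/
def intrinsicDist [Nonempty X] (x y : X) : ℝ≥0∞ :=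
  ⨆ (Z : Set X) (_ : P.IsNull Z), ⨅ (γ : ℝ → X)
    (_ : (∃ C : ℝ≥0, LipschitzOnWith C γ (Icc 0 1)) ∧ γ 0 = x ∧ γ 1 = y ∧
      volume (Icc (0 : ℝ) 1 ∩ γ ⁻¹' Z) = 0), P.pathLength γ

end RiemannianPolyhedron

/-! ### Hermitian manifolds -/

section Manifold

variable {E : Type*} [NormedAddCommGroup E] [NormedSpace ℂ E]
  {N : Type*} [TopologicalSpace N] [ChartedSpace E N]

/-- A complex manifold is a smooth real manifold. -/
instance isManifold_real_of_complex [IsManifold 𝓘(ℂ, E) ω N] : IsManifold 𝓘(ℝ, E) ∞ N := by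
  refine isManifold_of_contDiffOn _ _ _ fun e e' he he' => ?_
  have h := (HasGroupoid.compatible (G := contDiffGroupoid ω 𝓘(ℂ, E)) he he')
  rw [contDiffGroupoid, mem_groupoid_of_pregroupoid] at h
  exact (h.1.restrict_scalars ℝ).of_le le_top

/-- The complex structure `J` of the tangent spaces, that is, multiplication by `i`. The tangent
space at `y` is read in the preferred complex chart at `y`; as changes of charts are holomorphic,
`J` is multiplication by `i` in every complex chart. -/
def complexStructure (y : N) (ξ : TangentSpace 𝓘(ℝ, E) y) : TangentSpace 𝓘(ℝ, E) y :=
  (Complex.I • (show E from ξ) : E)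

variable [RiemannianBundle (fun y : N => TangentSpace 𝓘(ℝ, E) y)]

variable (E N) in
/-- The Riemannian metric of the complex manifold `N` is Hermitian: `g(Jξ, Jη) = g(ξ, η)`. -/
def IsHermitianMetric : Prop :=
  ∀ (y : N) (ξ η : TangentSpace 𝓘(ℝ, E) y),
    inner ℝ (complexStructure y ξ) (complexStructure y η) = inner ℝ ξ η

variable [FiniteDimensional ℂ E]

variable (E) in
/-- The gradient `∇_N v` at `y`: the tangent vector that represents the differential of `v`. -/
def riemannianGradient (v : N → ℝ) (y : N) : TangentSpace 𝓘(ℝ, E) y :=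
  haveI : FiniteDimensional ℝ (TangentSpace 𝓘(ℝ, E) y) := FiniteDimensional.complexToReal E
  haveI : CompleteSpace (TangentSpace 𝓘(ℝ, E) y) := FiniteDimensional.complete ℝ _
  (InnerProductSpace.toDual ℝ (TangentSpace 𝓘(ℝ, E) y)).symm (mfderiv 𝓘(ℝ, E) 𝓘(ℝ, ℝ) v y)

/-! ### Maps from a Riemannian polyhedron to a Hermitian manifold -/

namespace RiemannianPolyhedron

variable {X : Type*} [MetricSpace X] [MeasurableSpace X] [Nonempty X] {m : ℕ}
  (P : RiemannianPolyhedron X m)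

variable (E) in
/-- The approximate energy density of `φ|_U`, with `d_N` the Riemannian distance of `N`:
`e_ε(x) = ∫_{B(x, ε) ∩ U} d_N(φ(x), φ(x'))² / ε^{m+2} dμ_g(x')`. -/
def approxEnergyDensity (φ : X → N) (U : Set X) (ε : ℝ) (x : X) : ℝ≥0∞ :=
  ∫⁻ x' in {x' | P.intrinsicDist x x' < ENNReal.ofReal ε} ∩ U,
    riemannianEDist 𝓘(ℝ, E) (φ x) (φ x') ^ 2 / ENNReal.ofReal (ε ^ (m + 2)) ∂P.vol

variable (E) in
/-- The (Korevaar-Schoen) energy of `φ|_U`: the supremum over `f ∈ C_c(U, [0, 1])` of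
`limsup_{ε → 0} ∫ f e_ε dμ_g`. -/
def energy (φ : X → N) (U : Set X) : ℝ≥0∞ :=
  ⨆ (f : X → ℝ) (_ : Continuous f ∧ (∀ x, f x ∈ Icc (0 : ℝ) 1) ∧ HasCompactSupport f ∧
      tsupport f ⊆ U),
    limsup (fun ε : ℝ => ∫⁻ x in U, ENNReal.ofReal (f x) * P.approxEnergyDensity E φ U ε x ∂P.vol)
      (𝓝[>] 0)

variable (E) in
/-- The class `L²_loc(X, N)`. -/
def MemL2loc (φ : X → N) : Prop :=
  AEStronglyMeasurable φ P.vol ∧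
  ∃ q : N, ∀ C : Set X, IsCompact C →
    ∫⁻ x in C, riemannianEDist 𝓘(ℝ, E) (φ x) q ^ 2 ∂P.vol < ⊤

variable (E) in
/-- The class `W^{1,2}_loc(X, N)` of the maps that are locally of finite energy: the energy is
finite on every relatively compact domain. -/
def MemW12loc (φ : X → N) : Prop :=
  P.MemL2loc E φ ∧
  ∀ U : Set X, IsOpen U → IsConnected U → IsCompact (closure U) → P.energy E φ U < ⊤

variable (E) in
/-- `φ` is horizontally weakly conformal: it is continuous, of class `W^{1,2}_loc`, and there is a
scalar `lam` on `X` such that `⟨∇(v ∘ φ), ∇(w ∘ φ)⟩ = lam · (g_N(∇v, ∇w) ∘ φ)` a.e. in `X`, for all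
real functions `v, w` of class `C¹` on `N`. The (a.e. unique) gradients exist because `φ` is
continuous and of class `W^{1,2}_loc`. -/
def HorizontallyWeaklyConformal (φ : X → N) : Prop :=
  Continuous φ ∧ P.MemW12loc E φ ∧
  ∃ lam : X → ℝ, ∀ v w : N → ℝ,
    ContMDiff 𝓘(ℝ, E) 𝓘(ℝ, ℝ) 1 v → ContMDiff 𝓘(ℝ, E) 𝓘(ℝ, ℝ) 1 w →
    ∃ Gv Gw : P.Cell → EuclideanSpace ℝ (Fin m) → EuclideanSpace ℝ (Fin m),
      P.IsWeakGradient (v ∘ φ) univ Gv ∧ P.IsWeakGradient (w ∘ φ) univ Gw ∧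
      P.AlmostEverywhere fun Δ s =>
        P.gradInner Δ s (Gv Δ s) (Gw Δ s) = lam (P.point Δ s) *
          inner ℝ (riemannianGradient E v (φ (P.point Δ s)))
            (riemannianGradient E w (φ (P.point Δ s)))

variable (E) in
/-- `φ` is pseudo-horizontally weakly conformal: it is continuous, of class `W^{1,2}_loc`, and for
all holomorphic functions `v = v₁ + i v₂` and `w = w₁ + i w₂` on an open set `U` of `N`,
`⟨∇(w₁ ∘ φ), ∇(v₁ ∘ φ)⟩ - ⟨∇(w₂ ∘ φ), ∇(v₂ ∘ φ)⟩ = 0` and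
`⟨∇(w₂ ∘ φ), ∇(v₁ ∘ φ)⟩ + ⟨∇(w₁ ∘ φ), ∇(v₂ ∘ φ)⟩ = 0` a.e. in `φ⁻¹(U)`. The (a.e. unique) gradients
exist because `φ` is continuous and of class `W^{1,2}_loc`. -/
def PseudoHorizontallyWeaklyConformal (φ : X → N) : Prop :=
  Continuous φ ∧ P.MemW12loc E φ ∧
  ∀ (U : Set N) (v w : N → ℂ), IsOpen U →
    MDifferentiableOn 𝓘(ℂ, E) 𝓘(ℂ, ℂ) v U → MDifferentiableOn 𝓘(ℂ, E) 𝓘(ℂ, ℂ) w U →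
    ∃ Gv₁ Gv₂ Gw₁ Gw₂ : P.Cell → EuclideanSpace ℝ (Fin m) → EuclideanSpace ℝ (Fin m),
      P.IsWeakGradient (fun x => (v (φ x)).re) (φ ⁻¹' U) Gv₁ ∧
      P.IsWeakGradient (fun x => (v (φ x)).im) (φ ⁻¹' U) Gv₂ ∧
      P.IsWeakGradient (fun x => (w (φ x)).re) (φ ⁻¹' U) Gw₁ ∧
      P.IsWeakGradient (fun x => (w (φ x)).im) (φ ⁻¹' U) Gw₂ ∧
      P.AlmostEverywhere fun Δ s => φ (P.point Δ s) ∈ U →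
        P.gradInner Δ s (Gw₁ Δ s) (Gv₁ Δ s) - P.gradInner Δ s (Gw₂ Δ s) (Gv₂ Δ s) = 0 ∧
        P.gradInner Δ s (Gw₂ Δ s) (Gv₁ Δ s) + P.gradInner Δ s (Gw₁ Δ s) (Gv₂ Δ s) = 0

end RiemannianPolyhedron

end Manifold

end

/-!
Why horizontal weak conformality implies the pseudo-horizontal one: for a holomorphic function
`v = v₁ + i v₂` on an open subset of a Hermitian manifold, the Cauchy–Riemann equations read
`∇v₂ = J ∇v₁` (`riemannianGradient_im`). As `J` is an isometry with `J² = -1`, two holomorphic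
functions satisfy `⟨∇w₂, ∇v₂⟩ = ⟨∇w₁, ∇v₁⟩` and `⟨∇w₂, ∇v₁⟩ = -⟨∇w₁, ∇v₂⟩` on `N`. Horizontal weak
conformality multiplies these identities by the dilation and transports them to `X`. Since its
definition only speaks of `C¹` functions on all of `N`, holomorphic functions on an open set, which
are `C¹` by Cauchy's estimate (`contDiffOn_one_of_differentiableOn_complex`), are first cut off
around each point. Weak gradients are local (`HasWeakGradientOn.of_local`), unique almost everywhere
(`HasWeakGradientOn.ae_eq`), and can be glued (`HasWeakGradientOn.exists_of_local`), so that the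
localized statements give the statement on `φ⁻¹(U)`.

Conversely, let `N` have complex dimension one, and let `z = x + i y` be a holomorphic coordinate.
Pseudo-horizontal weak conformality for the pair `z`, `z` says that `∇(x ∘ φ)` and `∇(y ∘ φ)` are
orthogonal and of the same length, and on `N` the same is true of `∇x` and `∇y`. A `C¹` function on
`N` is locally `f(x, y)` with `f` of class `C¹`, so by the chain rule, on both sides, all inner
products of gradients are the same multiples of `|∇(x ∘ φ)|²` and of `|∇x|²`; the dilation is the
quotient of these two. It is a function on `X` because the open maximal simplexes are disjoint
(`LipTriangulation.eq_of_point_eq`).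

The chain rule on the source is the analytic core (`integral_fderiv_mul_comp_of_weak`). The gradient
is only known to be locally integrable, but the functions are continuous, so mollification
converges locally uniformly, which suffices to pass to the limit.
-/

/-! ### Weak gradients on open subsets of a Euclidean space -/

section WeakGradient

theorem MeasureTheory.LocallyIntegrableOn.integrable_smul_of_tsupport_subset {V A : Type*}
    [TopologicalSpace V] [T2Space V] [MeasurableSpace V] [BorelSpace V] [NormedAddCommGroup A]
    [NormedSpace ℝ A] {μ : Measure V} {f : V → A} {O : Set V} (hf : LocallyIntegrableOn f O μ)
    {ψ : V → ℝ} (hψ : Continuous ψ) (hc : HasCompactSupport ψ) (hO : tsupport ψ ⊆ O) :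
    Integrable (fun s => ψ s • f s) μ := by
  have h1 : IntegrableOn f (tsupport ψ) μ := hf.integrableOn_compact_subset hO hc
  have h2 : IntegrableOn (fun s => ψ s • f s) (tsupport ψ) μ :=
    h1.continuousOn_smul hψ.continuousOn hc
  refine (integrableOn_iff_integrable_of_support_subset ?_).1 h2
  intro s hs
  by_contra h
  exact hs (by simp [image_eq_zero_of_notMem_tsupport h])

theorem MeasureTheory.LocallyIntegrableOn.congr_ae {V A : Type*}
    [TopologicalSpace V] [MeasurableSpace V] [NormedAddCommGroup A]
    {μ : Measure V} {f g : V → A} {O : Set V} (hO : MeasurableSet O)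
    (hf : LocallyIntegrableOn f O μ) (h : ∀ᵐ s ∂μ, s ∈ O → f s = g s) :
    LocallyIntegrableOn g O μ := by
  intro x hx
  obtain ⟨t, ht, hi⟩ := hf x hx
  refine ⟨t ∩ O, inter_mem ht self_mem_nhdsWithin, (hi.mono_set inter_subset_left).congr ?_⟩
  exact ae_restrict_of_ae_restrict_of_subset inter_subset_right ((ae_restrict_iff' hO).2 h)

/-- A property that holds almost everywhere near each point of `O` holds almost everywhere
on `O`. -/
theorem ae_of_forall_exists_isOpen {V : Type*} [TopologicalSpace V] [SecondCountableTopology V]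
    [MeasurableSpace V] {μ : Measure V} {O : Set V} {p : V → Prop}
    (h : ∀ x ∈ O, ∃ O', IsOpen O' ∧ x ∈ O' ∧ ∀ᵐ s ∂μ, s ∈ O' → p s) :
    ∀ᵐ s ∂μ, s ∈ O → p s := by
  rw [ae_iff]
  refine measure_null_of_locally_null _ fun x hx => ?_
  simp only [Classical.not_imp, mem_ofPred_eq] at hx
  obtain ⟨O', hO', hxO', hp⟩ := h x hx.1
  refine ⟨O' ∩ {s | ¬(s ∈ O → p s)}, inter_mem (mem_nhdsWithin_of_mem_nhds
    (hO'.mem_nhds hxO')) self_mem_nhdsWithin, measure_mono_null ?_ (ae_iff.1 hp)⟩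
  rintro s ⟨hs, hs'⟩
  simp only [Classical.not_imp, mem_ofPred_eq] at hs' ⊢
  exact ⟨hs, hs'.2⟩

variable {m : ℕ}

/-- `G` is the family of weak partial derivatives of `u` on the open set `O` of `ℝᵐ`. The weak
gradients of a function on a polyhedron are such families, one on each maximal simplex. -/
def HasWeakGradientOn (u : EuclideanSpace ℝ (Fin m) → ℝ)
    (G : EuclideanSpace ℝ (Fin m) → EuclideanSpace ℝ (Fin m))
    (O : Set (EuclideanSpace ℝ (Fin m))) : Prop :=
  LocallyIntegrableOn u O ∧ LocallyIntegrableOn G O ∧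
    ∀ ψ : EuclideanSpace ℝ (Fin m) → ℝ, ContDiff ℝ ∞ ψ → HasCompactSupport ψ →
      tsupport ψ ⊆ O → ∀ i : Fin m,
        ∫ s, u s * fderiv ℝ ψ s (EuclideanSpace.single i 1) = - ∫ s, G s i * ψ s

namespace HasWeakGradientOn

variable {u v : EuclideanSpace ℝ (Fin m) → ℝ}
  {G H : EuclideanSpace ℝ (Fin m) → EuclideanSpace ℝ (Fin m)}
  {O O' : Set (EuclideanSpace ℝ (Fin m))}

theorem mono (h : HasWeakGradientOn u G O) (hO : O' ⊆ O) : HasWeakGradientOn u G O' :=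
  ⟨h.1.mono_set hO, h.2.1.mono_set hO, fun ψ h1 h2 h3 => h.2.2 ψ h1 h2 (h3.trans hO)⟩

theorem congr (hO : IsOpen O) (h : HasWeakGradientOn u G O) (huv : EqOn u v O)
    (hG : ∀ᵐ s, s ∈ O → G s = H s) : HasWeakGradientOn v H O := by
  refine ⟨h.1.congr_ae hO.measurableSet (.of_forall huv),
    h.2.1.congr_ae hO.measurableSet hG, fun ψ h1 h2 h3 i => ?_⟩
  have e1 : ∫ s, v s * fderiv ℝ ψ s (EuclideanSpace.single i 1)
      = ∫ s, u s * fderiv ℝ ψ s (EuclideanSpace.single i 1) := by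
    congr 1 with s
    by_cases hs : s ∈ tsupport ψ
    · rw [huv (h3 hs)]
    · simp [fderiv_of_notMem_tsupport ℝ hs]
  have e2 : ∫ s, H s i * ψ s = ∫ s, G s i * ψ s := by
    refine integral_congr_ae ?_
    filter_upwards [hG] with s hs
    by_cases hs' : s ∈ tsupport ψ
    · rw [hs (h3 hs')]
    · simp [image_eq_zero_of_notMem_tsupport hs']
  rw [e1, e2, h.2.2 ψ h1 h2 h3 i]

theorem apply_locallyIntegrableOn (h : HasWeakGradientOn u G O) (i : Fin m) :
    LocallyIntegrableOn (fun s => G s i) O := by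
  intro x hx
  obtain ⟨t, ht, hi⟩ := h.2.1 x hx
  exact ⟨t, ht, (EuclideanSpace.proj (𝕜 := ℝ) i).integrable_comp hi⟩

/-- Weak gradients are unique almost everywhere. -/
theorem ae_eq (hO : IsOpen O) (hG : HasWeakGradientOn u G O) (hH : HasWeakGradientOn u H O) :
    ∀ᵐ s, s ∈ O → G s = H s := by
  have key : ∀ i : Fin m, ∀ᵐ s, s ∈ O → G s i - H s i = 0 := by
    intro i
    refine hO.ae_eq_zero_of_integral_contDiff_smul_eq_zero
      ((hG.apply_locallyIntegrableOn i).sub (hH.apply_locallyIntegrableOn i))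
      fun ψ h1 h2 h3 => ?_
    have i1 := (hG.apply_locallyIntegrableOn i).integrable_smul_of_tsupport_subset
      h1.continuous h2 h3
    have i2 := (hH.apply_locallyIntegrableOn i).integrable_smul_of_tsupport_subset
      h1.continuous h2 h3
    have e := (hG.2.2 ψ h1 h2 h3 i).symm.trans (hH.2.2 ψ h1 h2 h3 i)
    simp only [smul_eq_mul, mul_comm (ψ _)] at i1 i2
    simp only [smul_eq_mul, mul_comm (ψ _), sub_mul]
    rw [integral_sub i1 i2]
    linarith
  filter_upwards [ae_all_iff.2 key] with s hs hsO
  ext i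
  exact sub_eq_zero.1 (hs i hsO)

/-- Being a weak gradient is a local property: a test function is split by a smooth partition of
unity. -/
theorem of_local (h : ∀ x ∈ O, ∃ O', IsOpen O' ∧ x ∈ O' ∧ HasWeakGradientOn u G O') :
    HasWeakGradientOn u G O := by
  choose! W hWo hxW hW using h
  have loc : ∀ {A : Type} [NormedAddCommGroup A] (f : EuclideanSpace ℝ (Fin m) → A),
      (∀ x ∈ O, LocallyIntegrableOn f (W x)) → LocallyIntegrableOn f O := by
    intro A _ f hf x hx
    have := hf x hx x (hxW x hx)
    rw [(hWo x hx).nhdsWithin_eq (hxW x hx)] at this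
    exact this.filter_mono nhdsWithin_le_nhds
  have hu := loc u fun x hx => (hW x hx).1
  have hG := loc G fun x hx => (hW x hx).2.1
  refine ⟨hu, hG, fun ψ h1 h2 h3 i => ?_⟩
  have hGi : LocallyIntegrableOn (fun s => G s i) O := by
    intro x hx
    obtain ⟨t, ht, hi⟩ := hG x hx
    exact ⟨t, ht, (EuclideanSpace.proj (𝕜 := ℝ) i).integrable_comp hi⟩
  obtain ⟨f, hf⟩ := SmoothPartitionOfUnity.exists_isSubordinate
    𝓘(ℝ, EuclideanSpace ℝ (Fin m)) (isClosed_tsupport ψ) (fun x : O => W x)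
    (fun x => hWo x x.2) (fun s hs => mem_iUnion.2 ⟨⟨s, h3 hs⟩, hxW s (h3 hs)⟩)
  have hfin : {x : O | (Function.support (f x) ∩ tsupport ψ).Nonempty}.Finite :=
    f.locallyFinite.finite_nonempty_inter_compact h2
  set F := hfin.toFinset with hF
  have hfs : ∀ x, ContDiff ℝ ∞ (f x) := fun x => (f x).contMDiff.contDiff
  have hsm : ∀ x, ContDiff ℝ ∞ (fun s => f x s * ψ s) := fun x => (hfs x).mul h1
  have hsupp : ∀ x, tsupport (fun s => f x s * ψ s) ⊆ tsupport ψ := fun x =>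
    tsupport_mul_subset_right
  have hsupp' : ∀ x, tsupport (fun s => f x s * ψ s) ⊆ tsupport (f x) := fun x =>
    tsupport_mul_subset_left
  have hcs : ∀ x, HasCompactSupport (fun s => f x s * ψ s) := fun x => h2.mul_left
  have hsum : ψ = fun s => ∑ x ∈ F, f x s * ψ s := by
    funext s
    by_cases hs : s ∈ tsupport ψ
    · have h4 := f.sum_eq_one hs
      rw [finsum_eq_sum_of_support_subset (s := F)] at h4
      · rw [← Finset.sum_mul, h4, one_mul]
      · intro x hx
        simp only [hF, Finite.coe_toFinset, mem_ofPred_eq]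
        exact ⟨s, hx, hs⟩
    · simp [image_eq_zero_of_notMem_tsupport hs]
  have hd : ∀ s, fderiv ℝ ψ s (EuclideanSpace.single i 1) =
      ∑ x ∈ F, fderiv ℝ (fun s => f x s * ψ s) s (EuclideanSpace.single i 1) := by
    intro s
    conv_lhs => rw [hsum]
    rw [fderiv_fun_sum fun x _ => ((hsm x).differentiable (by simp)).differentiableAt]
    simp
  have cont : ∀ x, Continuous fun s =>
      fderiv ℝ (fun s => f x s * ψ s) s (EuclideanSpace.single i 1) := fun x =>
    ((hsm x).continuous_fderiv (by simp)).clm_apply continuous_const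
  have hcd : ∀ x, HasCompactSupport fun s =>
      fderiv ℝ (fun s => f x s * ψ s) s (EuclideanSpace.single i 1) := fun x =>
    (hcs x).fderiv_apply ℝ _
  have hds : ∀ x, tsupport (fun s =>
      fderiv ℝ (fun s => f x s * ψ s) s (EuclideanSpace.single i 1)) ⊆ O := fun x =>
    (tsupport_fderiv_apply_subset ℝ _).trans ((hsupp x).trans h3)
  calc ∫ s, u s * fderiv ℝ ψ s (EuclideanSpace.single i 1)
      = ∑ x ∈ F, ∫ s, u s * fderiv ℝ (fun s => f x s * ψ s) s (EuclideanSpace.single i 1) := by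
        simp_rw [hd, Finset.mul_sum]
        refine integral_finsetSum _ fun x _ => ?_
        simpa only [smul_eq_mul, mul_comm] using
          hu.integrable_smul_of_tsupport_subset (cont x) (hcd x) (hds x)
    _ = ∑ x ∈ F, - ∫ s, G s i * (f x s * ψ s) := by
        refine Finset.sum_congr rfl fun x _ => ?_
        exact (hW x x.2).2.2 _ (hsm x) (hcs x) ((hsupp' x).trans (hf x)) i
    _ = - ∫ s, G s i * ψ s := by
        rw [Finset.sum_neg_distrib, ← integral_finsetSum]
        · congr 2 with s
          rw [← Finset.mul_sum]
          conv_rhs => rw [hsum]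
        · intro x _
          simpa only [smul_eq_mul, mul_comm] using
            hGi.integrable_smul_of_tsupport_subset (hsm x).continuous (hcs x)
              ((hsupp x).trans h3)

/-- A function that has weak gradients locally has a weak gradient: the local ones agree almost
everywhere on overlaps, and countably many of them suffice. -/
theorem exists_of_local (hO : IsOpen O)
    (h : ∀ x ∈ O, ∃ O', IsOpen O' ∧ x ∈ O' ∧ ∃ G, HasWeakGradientOn u G O') :
    ∃ G, HasWeakGradientOn u G O := by
  choose! W hWo hxW D hD using h
  obtain ⟨t, htO, htc, hcov⟩ := TopologicalSpace.countable_cover_nhdsWithin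
    (f := W) (s := O) fun x hx => mem_nhdsWithin_of_mem_nhds ((hWo x hx).mem_nhds (hxW x hx))
  have hcov' : ∀ s ∈ O, ∃ x ∈ t, s ∈ W x := fun s hs => by simpa using hcov hs
  choose! c hct hcW using hcov'
  have hagree : ∀ᵐ s, ∀ x ∈ t, ∀ y ∈ t, s ∈ W x ∩ W y → D x s = D y s := by
    refine (ae_ball_iff htc).2 fun x hx => (ae_ball_iff htc).2 fun y hy => ?_
    exact ae_eq ((hWo x (htO hx)).inter (hWo y (htO hy)))
      ((hD x (htO hx)).mono inter_subset_left) ((hD y (htO hy)).mono inter_subset_right)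
  refine ⟨fun s => D (c s) s, ?_⟩
  refine of_local fun x hx => ⟨W (c x) ∩ O, (hWo _ (htO (hct x hx))).inter hO,
    ⟨hcW x hx, hx⟩, ?_⟩
  refine congr ((hWo _ (htO (hct x hx))).inter hO)
    ((hD _ (htO (hct x hx))).mono inter_subset_left) (fun _ _ => rfl) ?_
  filter_upwards [hagree] with s hs hsW
  exact hs _ (hct x hx) _ (hct s hsW.2) ⟨hsW.1, hcW s hsW.2⟩

end HasWeakGradientOn

end WeakGradient

/-! ### The chain rule for weak derivatives of continuous functions -/

section ChainRule

open scoped Convolution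

variable {V A : Type*} [NormedAddCommGroup V] [NormedSpace ℝ V] [FiniteDimensional ℝ V]
  [MeasurableSpace V] [BorelSpace V] {μ : Measure V} [μ.IsAddHaarMeasure]
  [NormedAddCommGroup A] [NormedSpace ℝ A]

/-- Convolution with a test function turns a weak derivative into a derivative. -/
theorem fderiv_convolution_apply_of_weak {u H : V → A} {e : V} (hu : LocallyIntegrable u μ)
    (hw : ∀ ψ : V → ℝ, ContDiff ℝ ∞ ψ → HasCompactSupport ψ →
      ∫ s, fderiv ℝ ψ s e • u s ∂μ = -∫ s, ψ s • H s ∂μ)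
    {ρ : V → ℝ} (hρ : ContDiff ℝ ∞ ρ) (hc : HasCompactSupport ρ) (x : V) :
    fderiv ℝ (ρ ⋆[ContinuousLinearMap.lsmul ℝ ℝ, μ] u) x e = ∫ s, ρ (x - s) • H s ∂μ := by
  have h1 := hc.hasFDerivAt_convolution_left (ContinuousLinearMap.lsmul ℝ ℝ : ℝ →L[ℝ] A →L[ℝ] A)
    (hρ.of_le (by simp)) hu x
  have hsub : ContDiff ℝ ∞ fun s => ρ (x - s) := hρ.comp (contDiff_const.sub contDiff_id)
  have hcs : HasCompactSupport fun s => ρ (x - s) :=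
    hc.comp_homeomorph (Homeomorph.subLeft x)
  have hd : ∀ s, fderiv ℝ (fun s => ρ (x - s)) s e = - fderiv ℝ ρ (x - s) e := by
    intro s
    have h2 : HasFDerivAt (fun s => ρ (x - s)) ((fderiv ℝ ρ (x - s)).comp
        (-ContinuousLinearMap.id ℝ V)) s :=
      ((hρ.differentiable (by simp)).differentiableAt.hasFDerivAt).comp s
        ((hasFDerivAt_id s).const_sub x)
    simp [h2.fderiv]
  have h3 := hw _ hsub hcs
  simp_rw [hd, neg_smul, integral_neg, neg_inj] at h3
  have hex : ConvolutionExistsAt (fderiv ℝ ρ) u x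
      ((ContinuousLinearMap.lsmul ℝ ℝ : ℝ →L[ℝ] A →L[ℝ] A).precompL V) μ :=
    (hc.fderiv ℝ).convolutionExists_left _ (hρ.continuous_fderiv (by simp)) hu x
  rw [h1.fderiv, ← h3, convolution_eq_swap]
  have hex' : Integrable (fun t => ((ContinuousLinearMap.lsmul ℝ ℝ : ℝ →L[ℝ] A →L[ℝ] A).precompL V)
      (fderiv ℝ ρ (x - t)) (u t)) μ := hex.integrable_swap
  rw [ContinuousLinearMap.integral_apply hex' e]
  rfl

/-- The chain rule for a `C¹` function `f` of a compactly supported continuous function `u` that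
has the integrable weak derivative `H` in direction `e`. The mollifications of `u` satisfy it
classically; in the limit, the mollifier is moved from `H` to the test function times `Df(u)`,
which is continuous, so that pointwise convergence and domination suffice. -/
theorem integral_fderiv_mul_comp_of_weak [FiniteDimensional ℝ A] {u H : V → A} {e : V}
    (hu : Continuous u) (hcu : HasCompactSupport u) (hH : Integrable H μ)
    (hw : ∀ ψ : V → ℝ, ContDiff ℝ ∞ ψ → HasCompactSupport ψ →
      ∫ s, fderiv ℝ ψ s e • u s ∂μ = -∫ s, ψ s • H s ∂μ)
    {f : A → ℝ} (hf : ContDiff ℝ 1 f) {ψ : V → ℝ} (hψ : ContDiff ℝ ∞ ψ)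
    (hcψ : HasCompactSupport ψ) :
    ∫ s, fderiv ℝ ψ s e * f (u s) ∂μ = -∫ s, ψ s * fderiv ℝ f (u s) (H s) ∂μ := by
  have : ProperSpace A := FiniteDimensional.proper ℝ A
  let φ : ℕ → ContDiffBump (0 : V) := fun n =>
    ⟨1 / ((n : ℝ) + 1) / 2, 1 / ((n : ℝ) + 1), by positivity, half_lt_self (by positivity)⟩
  have hφ : Tendsto (fun n => (φ n).rOut) atTop (𝓝 0) := tendsto_one_div_add_atTop_nhds_zero_nat
  let ρ : ℕ → V → ℝ := fun n => (φ n).normed μ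
  have hρ : ∀ n, ContDiff ℝ ∞ (ρ n) := fun n => (φ n).contDiff_normed
  have hcρ : ∀ n, HasCompactSupport (ρ n) := fun n => (φ n).hasCompactSupport_normed
  have hρ0 : ∀ n x, 0 ≤ ρ n x := fun n x => (φ n).nonneg_normed x
  have hρ1 : ∀ n, ∫ x, ρ n x ∂μ = 1 := fun n => (φ n).integral_normed
  have hρs : ∀ n x y, ρ n (x - y) = ρ n (y - x) := fun n x y => by
    rw [← neg_sub]; exact (φ n).normed_neg _
  have hul : LocallyIntegrable u μ := hu.locallyIntegrable
  -- the mollifications of `u`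
  let U : ℕ → V → A := fun n => ρ n ⋆[ContinuousLinearMap.lsmul ℝ ℝ, μ] u
  have hU : ∀ n, ContDiff ℝ ∞ (U n) := fun n => (hcρ n).contDiff_convolution_left _ (hρ n) hul
  have hUd : ∀ n x, fderiv ℝ (U n) x e = ∫ s, ρ n (x - s) • H s ∂μ := fun n x =>
    fderiv_convolution_apply_of_weak hul hw (hρ n) (hcρ n) x
  -- a bound for averages
  have avg : ∀ {B : Type _} [NormedAddCommGroup B] [NormedSpace ℝ B] (g : V → B) (C : ℝ) n y,
      (∀ x, ‖g x‖ ≤ C) → ‖(ρ n ⋆[ContinuousLinearMap.lsmul ℝ ℝ, μ] g) y‖ ≤ C := by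
    intro B _ _ g C n y hg
    calc ‖∫ t, ρ n t • g (y - t) ∂μ‖ ≤ ∫ t, ρ n t * C ∂μ := by
          refine norm_integral_le_of_norm_le (((φ n).integrable_normed).mul_const C)
            (.of_forall fun t => ?_)
          rw [norm_smul, Real.norm_of_nonneg (hρ0 n t)]
          exact mul_le_mul_of_nonneg_left (hg _) (hρ0 n t)
      _ = C := by rw [integral_mul_const, hρ1, one_mul]
  obtain ⟨R, hR⟩ := hu.norm.bddAbove_range_of_hasCompactSupport hcu.norm
  have hR' : ∀ x, ‖u x‖ ≤ R := fun x => hR ⟨x, rfl⟩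
  have hUR : ∀ n x, ‖U n x‖ ≤ R := fun n x => avg u R n x hR'
  have hfd : Continuous (fderiv ℝ f) := hf.continuous_fderiv (by simp)
  obtain ⟨C, hC⟩ := ((isCompact_closedBall (0 : A) R).image hf.continuous.norm).bddAbove
  have hC' : ∀ a, ‖a‖ ≤ R → ‖f a‖ ≤ C := fun a ha => hC ⟨a, by simpa using ha, rfl⟩
  obtain ⟨C₁, hC₁⟩ := ((isCompact_closedBall (0 : A) R).image hfd.norm).bddAbove
  have hC₁' : ∀ a, ‖a‖ ≤ R → ‖fderiv ℝ f a‖ ≤ C₁ := fun a ha => hC₁ ⟨a, by simpa using ha, rfl⟩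
  obtain ⟨M, hM⟩ := hψ.continuous.norm.bddAbove_range_of_hasCompactSupport hcψ.norm
  have hM' : ∀ x, ‖ψ x‖ ≤ M := fun x => hM ⟨x, rfl⟩
  have hM0 : 0 ≤ M := (norm_nonneg _).trans (hM' 0)
  have hC₁0 : 0 ≤ C₁ := (norm_nonneg _).trans (hC₁' (u 0) (hR' 0))
  have hUlim : ∀ x, Tendsto (Function.uncurry U) (atTop ×ˢ 𝓝 x) (𝓝 (u x)) := by
    intro x
    have := ContDiffBump.convolution_tendsto_right (μ := μ) (φ := fun p : ℕ × V => φ p.1)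
      (g := fun _ => u) (k := Prod.snd) (l := atTop ×ˢ 𝓝 x) (hφ.comp tendsto_fst)
      (.of_forall fun _ => hu.aestronglyMeasurable)
      ((hu.tendsto x).comp tendsto_snd) tendsto_snd
    exact this
  have hUs : ∀ x, Tendsto (fun n => U n x) atTop (𝓝 (u x)) := fun x =>
    ContDiffBump.convolution_tendsto_right_of_continuous hφ hu x
  -- the test function times `Df(u)`
  let L : ℕ → V → (A →L[ℝ] ℝ) := fun n x => ψ x • fderiv ℝ f (U n x)
  have hLc : ∀ n, Continuous (L n) := fun n =>
    hψ.continuous.smul (hfd.comp (hU n).continuous)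
  have hLb : ∀ n x, ‖L n x‖ ≤ M * C₁ := fun n x => by
    rw [norm_smul]
    exact mul_le_mul (hM' x) (hC₁' _ (hUR n x)) (norm_nonneg _) hM0
  let D : ℕ → V → (A →L[ℝ] ℝ) := fun n => ρ n ⋆[ContinuousLinearMap.lsmul ℝ ℝ, μ] L n
  have hDlim : ∀ y, Tendsto (fun n => D n y) atTop (𝓝 (ψ y • fderiv ℝ f (u y))) := by
    intro y
    refine ContDiffBump.convolution_tendsto_right hφ
      (.of_forall fun n => (hLc n).aestronglyMeasurable) ?_ tendsto_const_nhds
    exact ((hψ.continuous.tendsto y).comp tendsto_snd).smul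
      ((hfd.tendsto (u y)).comp (hUlim y))
  have hDb : ∀ n y, ‖D n y‖ ≤ M * C₁ := fun n y => avg (L n) _ n y (hLb n)
  have hLcs : ∀ n, HasCompactSupport (L n) := fun n => hcψ.smul_right
  have hDc : ∀ n, Continuous (D n) := fun n =>
    (hcρ n).continuous_convolution_left _ (hρ n).continuous (hLc n).locallyIntegrable
  -- the chain rule for the mollifications
  have step : ∀ n, ∫ s, fderiv ℝ ψ s e * f (U n s) ∂μ = -∫ y, D n y (H y) ∂μ := by
    intro n
    have hfU : ContDiff ℝ 1 fun s => f (U n s) := hf.comp ((hU n).of_le (by simp))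
    have cψ' : Continuous fun s => fderiv ℝ ψ s e :=
      (hψ.continuous_fderiv (by simp)).clm_apply continuous_const
    have cfU' : Continuous fun s => fderiv ℝ (fun s => f (U n s)) s e :=
      (hfU.continuous_fderiv (by simp)).clm_apply continuous_const
    have i1 : Integrable (fun s => fderiv ℝ ψ s e * f (U n s)) μ :=
      (cψ'.mul hfU.continuous).integrable_of_hasCompactSupport
        ((hcψ.fderiv_apply ℝ e).mul_right)
    have i2 : Integrable (fun s => ψ s * fderiv ℝ (fun s => f (U n s)) s e) μ :=
      (hψ.continuous.mul cfU').integrable_of_hasCompactSupport hcψ.mul_right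
    have i3 : Integrable (fun s => ψ s * f (U n s)) μ :=
      (hψ.continuous.mul hfU.continuous).integrable_of_hasCompactSupport hcψ.mul_right
    have ibp := integral_mul_fderiv_eq_neg_fderiv_mul_of_integrable i1 i2 i3
      (fun x _ => (hψ.differentiable (by simp)).differentiableAt)
      (fun x _ => (hfU.differentiable (by simp)).differentiableAt)
    have e1 : ∀ x, ψ x * fderiv ℝ (fun s => f (U n s)) x e =
        ∫ y, ρ n (x - y) * L n x (H y) ∂μ := by
      intro x
      have hint : Integrable (fun s => ρ n (x - s) • H s) μ := by
        refine hH.locallyIntegrable.integrable_smul_left_of_hasCompactSupport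
          ((hρ n).continuous.comp (continuous_const.sub continuous_id)) ?_
        exact (hcρ n).comp_homeomorph (Homeomorph.subLeft x)
      have h2 : fderiv ℝ (fun s => f (U n s)) x e = fderiv ℝ f (U n x) (fderiv ℝ (U n) x e) := by
        have := ((hf.differentiable (by simp)).differentiableAt.hasFDerivAt (x := U n x)).comp x
          (((hU n).differentiable (by simp)).differentiableAt.hasFDerivAt (x := x))
        rw [show (fun s => f (U n s)) = f ∘ U n from rfl, this.fderiv]
        rfl
      rw [h2, hUd, ← ContinuousLinearMap.integral_comp_comm _ hint, ← integral_const_mul]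
      congr 1 with y
      simp [L]
      ring
    have hswap : Integrable (Function.uncurry fun x y => ρ n (x - y) * L n x (H y))
        (μ.prod μ) := by
      obtain ⟨B, hB⟩ := (hρ n).continuous.norm.bddAbove_range_of_hasCompactSupport (hcρ n).norm
      have hB' : ∀ x, ‖ρ n x‖ ≤ B := fun x => hB ⟨x, rfl⟩
      have hLi : Integrable (fun x => B * ‖L n x‖) μ :=
        (((hLc n).integrable_of_hasCompactSupport (hLcs n)).norm).const_mul B
      refine (hLi.mul_prod hH.norm).mono' ?_ (.of_forall fun p => ?_)
      · refine AEStronglyMeasurable.mul ?_ ?_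
        · exact ((hρ n).continuous.comp
            (continuous_fst.sub continuous_snd)).aestronglyMeasurable
        · exact (isBoundedBilinearMap_apply (𝕜 := ℝ) (E := A) (F := ℝ)).continuous
            |>.comp_aestronglyMeasurable (((hLc n).comp continuous_fst).aestronglyMeasurable.prodMk
              (hH.aestronglyMeasurable.comp_snd))
      · simp only [Function.uncurry, norm_mul]
        rw [mul_assoc]
        exact mul_le_mul (hB' _) ((L n p.1).le_opNorm _) (norm_nonneg _)
          ((norm_nonneg _).trans (hB' 0))
    have e2 : ∀ y, ∫ x, ρ n (x - y) * L n x (H y) ∂μ = D n y (H y) := by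
      intro y
      have hint : Integrable (fun x => ρ n (y - x) • L n x) μ := by
        refine ((hLc n).locallyIntegrable).integrable_smul_left_of_hasCompactSupport
          ((hρ n).continuous.comp (continuous_const.sub continuous_id)) ?_
        exact (hcρ n).comp_homeomorph (Homeomorph.subLeft y)
      change _ = (ρ n ⋆[ContinuousLinearMap.lsmul ℝ ℝ, μ] L n) y (H y)
      rw [convolution_eq_swap]
      simp only [ContinuousLinearMap.lsmul_apply]
      rw [ContinuousLinearMap.integral_apply hint]
      congr 1 with x
      simp [hρs n x y]
    rw [← neg_eq_iff_eq_neg.2 ibp]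
    congr 1
    simp_rw [e1]
    rw [integral_integral_swap hswap]
    simp_rw [e2]
  have cψ' : Continuous fun s => fderiv ℝ ψ s e :=
    (hψ.continuous_fderiv (by simp)).clm_apply continuous_const
  have lim1 : Tendsto (fun n => ∫ s, fderiv ℝ ψ s e * f (U n s) ∂μ) atTop
      (𝓝 (∫ s, fderiv ℝ ψ s e * f (u s) ∂μ)) := by
    refine tendsto_integral_of_dominated_convergence (fun s => ‖fderiv ℝ ψ s e‖ * C)
      (fun n => (cψ'.mul (hf.continuous.comp (hU n).continuous)).aestronglyMeasurable) ?_ ?_ ?_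
    · exact ((cψ'.integrable_of_hasCompactSupport (hcψ.fderiv_apply ℝ e)).norm).mul_const C
    · refine fun n => .of_forall fun s => ?_
      rw [norm_mul]
      exact mul_le_mul_of_nonneg_left (hC' _ (hUR n s)) (norm_nonneg _)
    · exact .of_forall fun s => tendsto_const_nhds.mul ((hf.continuous.tendsto _).comp (hUs s))
  have lim2 : Tendsto (fun n => ∫ y, D n y (H y) ∂μ) atTop
      (𝓝 (∫ s, ψ s * fderiv ℝ f (u s) (H s) ∂μ)) := by
    refine tendsto_integral_of_dominated_convergence (fun y => M * C₁ * ‖H y‖)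
      (fun n => ?_) (hH.norm.const_mul _) ?_ ?_
    · exact (isBoundedBilinearMap_apply (𝕜 := ℝ) (E := A) (F := ℝ)).continuous
        |>.comp_aestronglyMeasurable ((hDc n).aestronglyMeasurable.prodMk hH.aestronglyMeasurable)
    · refine fun n => .of_forall fun y => ((D n y).le_opNorm _).trans ?_
      exact mul_le_mul_of_nonneg_right (hDb n y) (norm_nonneg _)
    · refine .of_forall fun y => ?_
      exact ((ContinuousLinearMap.apply ℝ ℝ (H y)).continuous.tendsto _).comp (hDlim y)
  simp_rw [step] at lim1
  exact tendsto_nhds_unique lim1 lim2.neg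

end ChainRule

section LocalChainRule

variable {m : ℕ}

namespace HasWeakGradientOn

/-- The chain rule for a `C¹` function of two continuous functions with weak gradients, written as
the real and the imaginary part of one complex valued function. -/
theorem comp_contDiffOn {u : EuclideanSpace ℝ (Fin m) → ℂ}
    {G₁ G₂ : EuclideanSpace ℝ (Fin m) → EuclideanSpace ℝ (Fin m)}
    {O : Set (EuclideanSpace ℝ (Fin m))} (hO : IsOpen O) (hu : ContinuousOn u O)
    (h₁ : HasWeakGradientOn (fun s => (u s).re) G₁ O)
    (h₂ : HasWeakGradientOn (fun s => (u s).im) G₂ O)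
    {f : ℂ → ℝ} {W : Set ℂ} (hW : IsOpen W) (hf : ContDiffOn ℝ 1 f W) (huW : MapsTo u O W) :
    HasWeakGradientOn (fun s => f (u s))
      (fun s => fderiv ℝ f (u s) 1 • G₁ s + fderiv ℝ f (u s) Complex.I • G₂ s) O := by
  have hdf : ContinuousOn (fun s => fderiv ℝ f (u s)) O :=
    (hf.continuousOn_fderiv_of_isOpen hW le_rfl).comp hu huW
  have li1 : LocallyIntegrableOn (fun s => f (u s)) O :=
    (hf.continuousOn.comp hu huW).locallyIntegrableOn hO.measurableSet
  have li2 : LocallyIntegrableOn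
      (fun s => fderiv ℝ f (u s) 1 • G₁ s + fderiv ℝ f (u s) Complex.I • G₂ s) O :=
    (h₁.2.1.continuousOn_smul hO.isLocallyClosed (hdf.clm_apply continuousOn_const)).add
      (h₂.2.1.continuousOn_smul hO.isLocallyClosed (hdf.clm_apply continuousOn_const))
  refine of_local fun x hx => ?_
  -- near the value `u x`, replace `f` by a function that is `C¹` everywhere
  obtain ⟨r, hr, hrW⟩ := Metric.isOpen_iff.1 hW (u x) (huW hx)
  let χ : ContDiffBump (u x) := ⟨r / 4, r / 2, by positivity, by linarith⟩
  have hχW : tsupport χ ⊆ W := by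
    rw [χ.tsupport_eq]
    exact (Metric.closedBall_subset_ball (half_lt_self hr)).trans hrW
  have hf' : ContDiff ℝ 1 fun z => χ z * f z := by
    rw [contDiff_iff_contDiffAt]
    intro z
    by_cases hz : z ∈ tsupport χ
    · exact χ.contDiff.contDiffAt.mul (hf.contDiffAt (hW.mem_nhds (hχW hz)))
    · refine (contDiffAt_const (c := (0 : ℝ))).congr_of_eventuallyEq ?_
      filter_upwards [(isClosed_tsupport χ).isOpen_compl.mem_nhds hz] with w hw
      simp [image_eq_zero_of_notMem_tsupport hw]
  have hff' : ∀ z ∈ Metric.ball (u x) (r / 4), (fun z => χ z * f z) =ᶠ[𝓝 z] f := by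
    intro z hz
    filter_upwards [Metric.isOpen_ball.mem_nhds hz] with w hw
    simp [χ.one_of_mem_closedBall (Metric.ball_subset_closedBall hw)]
  -- near `x`, replace `u` by a function that is continuous with compact support
  have hpre : IsOpen (O ∩ u ⁻¹' Metric.ball (u x) (r / 4)) :=
    hu.isOpen_inter_preimage hO Metric.isOpen_ball
  obtain ⟨δ, hδ, hδO⟩ := Metric.isOpen_iff.1 hpre x ⟨hx, Metric.mem_ball_self (by positivity)⟩
  let η : ContDiffBump x := ⟨δ / 4, δ / 2, by positivity, by linarith⟩
  have hηO : tsupport η ⊆ O := by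
    rw [η.tsupport_eq]
    exact (Metric.closedBall_subset_ball (half_lt_self hδ)).trans (hδO.trans inter_subset_left)
  have hη : ContDiff ℝ ∞ η := η.contDiff
  have hηc : HasCompactSupport η := η.hasCompactSupport
  have hul : LocallyIntegrableOn u O := hu.locallyIntegrableOn hO.measurableSet
  have hu'c : Continuous fun s => η s • u s := by
    rw [continuous_iff_continuousAt]
    intro z
    by_cases hz : z ∈ tsupport η
    · exact hη.continuous.continuousAt.smul (hu.continuousAt (hO.mem_nhds (hηO hz)))
    · refine (continuousAt_const (y := (0 : ℂ))).congr ?_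
      filter_upwards [(isClosed_tsupport η).isOpen_compl.mem_nhds hz] with w hw
      simp [image_eq_zero_of_notMem_tsupport hw]
  have hball : Metric.ball x (δ / 4) ⊆ O := (Metric.ball_subset_ball (by linarith)).trans
    (hδO.trans inter_subset_left)
  refine ⟨Metric.ball x (δ / 4), Metric.isOpen_ball, Metric.mem_ball_self (by positivity),
    li1.mono_set hball, li2.mono_set hball, fun ψ hψ hcψ hsψ i => ?_⟩
  have hg : LocallyIntegrableOn (fun s => (G₁ s i : ℂ) + Complex.I * (G₂ s i : ℂ)) O := by
    have a1 : LocallyIntegrableOn (fun s => (G₁ s i : ℂ)) O := fun y hy => by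
      obtain ⟨t, ht, hi⟩ := h₁.apply_locallyIntegrableOn i y hy
      exact ⟨t, ht, hi.ofReal⟩
    have a2 : LocallyIntegrableOn (fun s => Complex.I * (G₂ s i : ℂ)) O := fun y hy => by
      obtain ⟨t, ht, hi⟩ := h₂.apply_locallyIntegrableOn i y hy
      exact ⟨t, ht, (hi.ofReal (𝕜 := ℂ)).const_mul _⟩
    exact a1.add a2
  set g : EuclideanSpace ℝ (Fin m) → ℂ := fun s => (G₁ s i : ℂ) + Complex.I * (G₂ s i : ℂ)
    with hgdef
  set e : EuclideanSpace ℝ (Fin m) := EuclideanSpace.single i 1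
  have hdη : Continuous fun s => fderiv ℝ η s e :=
    (hη.continuous_fderiv (by simp)).clm_apply continuous_const
  have cplx : ∀ ψ : EuclideanSpace ℝ (Fin m) → ℝ, ContDiff ℝ ∞ ψ → HasCompactSupport ψ →
      tsupport ψ ⊆ O → ∫ s, fderiv ℝ ψ s e • u s = -∫ s, ψ s • g s := by
    intro ψ h1 h2 h3
    have b1 : Integrable fun s => fderiv ℝ ψ s e • u s :=
      hul.integrable_smul_of_tsupport_subset
        ((h1.continuous_fderiv (by simp)).clm_apply continuous_const) (h2.fderiv_apply ℝ e)
        ((tsupport_fderiv_apply_subset ℝ e).trans h3)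
    have b2 : Integrable fun s => ψ s • g s :=
      hg.integrable_smul_of_tsupport_subset h1.continuous h2 h3
    apply Complex.ext
    · have c1 := Complex.reCLM.integral_comp_comm b1
      have c2 := Complex.reCLM.integral_comp_comm b2
      simp only [Complex.reCLM_apply] at c1 c2
      rw [Complex.neg_re, ← c1, ← c2]
      have := h₁.2.2 ψ h1 h2 h3 i
      simpa [hgdef, mul_comm] using this
    · have c1 := Complex.imCLM.integral_comp_comm b1
      have c2 := Complex.imCLM.integral_comp_comm b2
      simp only [Complex.imCLM_apply] at c1 c2
      rw [Complex.neg_im, ← c1, ← c2]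
      have := h₂.2.2 ψ h1 h2 h3 i
      simpa [hgdef, mul_comm] using this
  let H : EuclideanSpace ℝ (Fin m) → ℂ := fun s => η s • g s + fderiv ℝ η s e • u s
  have hH1 : Integrable fun s => η s • g s :=
    hg.integrable_smul_of_tsupport_subset hη.continuous hηc hηO
  have hH2 : Integrable fun s => fderiv ℝ η s e • u s :=
    hul.integrable_smul_of_tsupport_subset hdη (hηc.fderiv_apply ℝ e)
      ((tsupport_fderiv_apply_subset ℝ e).trans hηO)
  have hH : Integrable H := hH1.add hH2
  have hw : ∀ ψ : EuclideanSpace ℝ (Fin m) → ℝ, ContDiff ℝ ∞ ψ → HasCompactSupport ψ →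
      ∫ s, fderiv ℝ ψ s e • (η s • u s) = -∫ s, ψ s • H s := by
    intro ψ h1 h2
    have hsub : tsupport (fun s => ψ s * η s) ⊆ O := tsupport_mul_subset_right.trans hηO
    have b := cplx (fun s => ψ s * η s) (h1.mul hη) h2.mul_right hsub
    have hd : ∀ s, fderiv ℝ (fun s => ψ s * η s) s e =
        ψ s * fderiv ℝ η s e + fderiv ℝ ψ s e * η s := by
      intro s
      rw [fderiv_fun_mul (h1.differentiable (by simp)).differentiableAt
        (hη.differentiable (by simp)).differentiableAt]
      simp [mul_comm]
    have j1 : Integrable fun s => ψ s • (fderiv ℝ η s e • u s) :=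
      hH2.locallyIntegrable.integrable_smul_left_of_hasCompactSupport h1.continuous h2
    have j2 : Integrable fun s => fderiv ℝ ψ s e • (η s • u s) :=
      hu'c.locallyIntegrable.integrable_smul_left_of_hasCompactSupport
        ((h1.continuous_fderiv (by simp)).clm_apply continuous_const) (h2.fderiv_apply ℝ e)
    have j3 : Integrable fun s => ψ s • (η s • g s) :=
      hH1.locallyIntegrable.integrable_smul_left_of_hasCompactSupport h1.continuous h2
    simp_rw [hd, add_smul, mul_smul] at b
    rw [integral_add j1 j2] at b
    simp only [H, smul_add]
    rw [integral_add j3 j1, neg_add, ← b]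
    ring
  have main := integral_fderiv_mul_comp_of_weak (e := e) hu'c hηc.smul_right hH hw hf' hψ hcψ
  have hon : ∀ s ∈ tsupport ψ, η s = 1 ∧ fderiv ℝ η s e = 0 ∧
      (fun z => χ z * f z) =ᶠ[𝓝 (u s)] f := by
    intro s hs
    have hs' := hsψ hs
    refine ⟨η.one_of_mem_closedBall (Metric.ball_subset_closedBall hs'), ?_, hff' _ ?_⟩
    · have : (η : EuclideanSpace ℝ (Fin m) → ℝ) =ᶠ[𝓝 s] fun _ => 1 := by
        filter_upwards [Metric.isOpen_ball.mem_nhds hs'] with w hw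
        exact η.one_of_mem_closedBall (Metric.ball_subset_closedBall hw)
      rw [this.fderiv_eq]
      simp
    · exact (hδO (Metric.ball_subset_ball (by linarith) hs')).2
  calc ∫ s, f (u s) * fderiv ℝ ψ s e
      = ∫ s, fderiv ℝ ψ s e * (χ (η s • u s) * f (η s • u s)) := by
        congr 1 with s
        by_cases hs : s ∈ tsupport ψ
        · obtain ⟨q1, q2, q3⟩ := hon s hs
          have : χ (u s) * f (u s) = f (u s) := q3.eq_of_nhds
          rw [q1, one_smul, this, mul_comm]
        · simp [fderiv_of_notMem_tsupport ℝ hs]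
    _ = _ := main
    _ = _ := by
        congr 2 with s
        by_cases hs : s ∈ tsupport ψ
        · obtain ⟨q1, q2, q3⟩ := hon s hs
          simp only [H]
          rw [q1, q2, one_smul, one_smul, zero_smul, add_zero, q3.fderiv_eq, hgdef]
          have : (G₁ s i : ℂ) + Complex.I * (G₂ s i : ℂ)
              = G₁ s i • (1 : ℂ) + G₂ s i • Complex.I := by
            simp [mul_comm]
          simp only [this, map_add, map_smul]
          simp
          ring
        · simp [image_eq_zero_of_notMem_tsupport hs]

end HasWeakGradientOn

end LocalChainRule

/-! ### Holomorphic functions on complex manifolds -/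

section Holomorphic

variable {E : Type*} [NormedAddCommGroup E] [NormedSpace ℂ E]

/-- Complex differentiable functions of several variables are `C¹`: by Cauchy's estimate on the
circles `ζ ↦ z + ζ e`, the difference of two derivatives is bounded by the oscillation of the
function. -/
theorem contDiffOn_one_of_differentiableOn_complex [FiniteDimensional ℂ E] {F : Type*}
    [NormedAddCommGroup F] [NormedSpace ℂ F] {f : E → F} {W : Set E} (hf : DifferentiableOn ℂ f W)
    (hW : IsOpen W) : ContDiffOn ℂ 1 f W := by
  have : ProperSpace E := FiniteDimensional.proper ℂ E
  rw [show (1 : ℕ∞ω) = 0 + 1 from rfl, contDiffOn_succ_iff_fderiv_of_isOpen hW]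
  refine ⟨hf, by simp, contDiffOn_zero.2 fun z₀ hz₀ => ContinuousAt.continuousWithinAt ?_⟩
  obtain ⟨r, hr, hrW⟩ := Metric.isOpen_iff.1 hW z₀ hz₀
  set R := r / 4 with hR
  have hR0 : 0 < R := by positivity
  have hcW : Metric.closedBall z₀ (2 * R) ⊆ W :=
    (Metric.closedBall_subset_ball (by linarith)).trans hrW
  have huc := (isCompact_closedBall z₀ (2 * R)).uniformContinuousOn_of_continuous
    (hf.continuousOn.mono hcW)
  rw [Metric.uniformContinuousOn_iff] at huc
  rw [Metric.continuousAt_iff]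
  intro ε hε
  obtain ⟨δ, hδ, hfδ⟩ := huc (ε / 2 * R) (by positivity)
  refine ⟨min δ R, lt_min hδ hR0, fun {z} hz => ?_⟩
  have hzδ := hz.trans_le (min_le_left _ _)
  have hzR := hz.trans_le (min_le_right _ _)
  have hin : ∀ w : E, dist w z₀ < R → ∀ e : E, ‖e‖ ≤ 1 → ∀ ζ ∈ Metric.closedBall (0 : ℂ) R,
      w + ζ • e ∈ Metric.closedBall z₀ (2 * R) := by
    intro w hw e he ζ hζ
    rw [mem_closedBall_zero_iff] at hζ
    rw [Metric.mem_closedBall, dist_eq_norm, add_sub_right_comm]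
    rw [dist_eq_norm] at hw
    refine (norm_add_le _ _).trans ?_
    rw [norm_smul]
    have : ‖ζ‖ * ‖e‖ ≤ R * 1 := mul_le_mul hζ he (norm_nonneg _) hR0.le
    linarith
  have hdiff : ∀ w : E, dist w z₀ < R → ∀ e : E, ‖e‖ ≤ 1 → ∀ ζ ∈ Metric.closedBall (0 : ℂ) R,
      HasDerivAt (fun ζ : ℂ => f (w + ζ • e)) (fderiv ℂ f (w + ζ • e) e) ζ := by
    intro w hw e he ζ hζ
    have h1 := (hf.differentiableAt
      (hW.mem_nhds (hcW (hin w hw e he ζ hζ)))).hasFDerivAt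
    have h2 : HasDerivAt (fun ζ : ℂ => w + ζ • e) e ζ := by
      simpa using ((hasDerivAt_id ζ).smul_const e).const_add w
    exact h1.comp_hasDerivAt ζ h2
  have h00 : dist z₀ z₀ < R := by simpa using hR0
  have key : ∀ e : E, ‖e‖ ≤ 1 → ‖(fderiv ℂ f z - fderiv ℂ f z₀) e‖ ≤ ε / 2 := by
    intro e he
    have hd : ∀ ζ ∈ Metric.closedBall (0 : ℂ) R,
        HasDerivAt (fun ζ : ℂ => f (z + ζ • e) - f (z₀ + ζ • e))
          (fderiv ℂ f (z + ζ • e) e - fderiv ℂ f (z₀ + ζ • e) e) ζ := fun ζ hζ =>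
      (hdiff z hzR e he ζ hζ).sub (hdiff z₀ h00 e he ζ hζ)
    have hc : DiffContOnCl ℂ (fun ζ : ℂ => f (z + ζ • e) - f (z₀ + ζ • e))
        (Metric.ball (0 : ℂ) R) := by
      refine DifferentiableOn.diffContOnCl fun ζ hζ => ?_
      exact (hd ζ
        (Metric.closure_ball_subset_closedBall hζ)).differentiableAt.differentiableWithinAt
    have hest := Complex.norm_deriv_le_of_forall_mem_sphere_norm_le hR0 hc
      (C := ε / 2 * R) fun ζ hζ => by
        have hζ' := Metric.sphere_subset_closedBall hζ
        have := hfδ _ (hin z hzR e he ζ hζ') _ (hin z₀ h00 e he ζ hζ') (by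
          rwa [dist_add_right])
        rw [dist_eq_norm] at this
        exact this.le
    have h0 := (hd 0 (Metric.mem_closedBall_self hR0.le)).deriv
    rw [h0, mul_div_cancel_right₀ _ hR0.ne'] at hest
    simpa using hest
  rw [dist_eq_norm]
  refine (ContinuousLinearMap.opNorm_le_of_unit_norm (𝕜 := ℂ) (by positivity) ?_).trans_lt
    (half_lt_self hε)
  intro e he
  exact key e he.le

variable {N : Type*} [TopologicalSpace N] [ChartedSpace E N]

theorem HasMFDerivAt.restrictScalars_real {v : N → ℂ} {y : N} {L : E →L[ℂ] ℂ}
    (h : HasMFDerivAt 𝓘(ℂ, E) 𝓘(ℂ, ℂ) v y L) :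
    HasMFDerivAt 𝓘(ℝ, E) 𝓘(ℝ, ℂ) v y (L.restrictScalars ℝ) :=
  ⟨h.1, HasFDerivWithinAt.restrictScalars ℝ h.2⟩

theorem MDifferentiableOn.contMDiffOn_one_real [FiniteDimensional ℂ E] [IsManifold 𝓘(ℂ, E) ω N]
    {v : N → ℂ} {U : Set N} (hU : IsOpen U) (hv : MDifferentiableOn 𝓘(ℂ, E) 𝓘(ℂ, ℂ) v U) :
    ContMDiffOn 𝓘(ℝ, E) 𝓘(ℝ, ℂ) 1 v U := by
  have : IsManifold 𝓘(ℂ, E) 1 N := IsManifold.of_le (n := ω) (by simp)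
  intro y hy
  refine ContMDiffAt.contMDiffWithinAt ?_
  set c := chartAt E y
  have hO : IsOpen (c.target ∩ c.symm ⁻¹' U) := c.symm.isOpen_inter_preimage hU
  have hd : DifferentiableOn ℂ (v ∘ c.symm) (c.target ∩ c.symm ⁻¹' U) := by
    rw [← mdifferentiableOn_iff_differentiableOn]
    exact hv.comp ((mdifferentiableOn_atlas_symm (chart_mem_atlas E y)).mono inter_subset_left)
      fun x hx => hx.2
  have hcd := ((contDiffOn_one_of_differentiableOn_complex hd hO).restrict_scalars ℝ).contDiffAt
    (hO.mem_nhds (x := c y) ⟨c.map_source (mem_chart_source E y), by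
      simpa [c, c.left_inv (mem_chart_source E y)] using hy⟩)
  rw [contMDiffAt_iff]
  refine ⟨(hv.continuousOn).continuousAt (hU.mem_nhds hy), ?_⟩
  change ContDiffWithinAt ℝ 1 (v ∘ c.symm) (range id) (c y)
  exact hcd.contDiffWithinAt

/-- Near each point of an open set, a `C¹` function on this set agrees with a function that is
`C¹` on the whole manifold. -/
theorem ContMDiffOn.exists_contMDiff_eventuallyEq {E N : Type*} [NormedAddCommGroup E]
    [NormedSpace ℝ E] [FiniteDimensional ℝ E] [TopologicalSpace N] [T2Space N] [ChartedSpace E N]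
    [IsManifold 𝓘(ℝ, E) ∞ N] {h : N → ℝ} {U : Set N} (hU : IsOpen U)
    (hh : ContMDiffOn 𝓘(ℝ, E) 𝓘(ℝ, ℝ) 1 h U) {y : N} (hy : y ∈ U) :
    ∃ h' : N → ℝ, ContMDiff 𝓘(ℝ, E) 𝓘(ℝ, ℝ) 1 h' ∧ h' =ᶠ[𝓝 y] h := by
  obtain ⟨χ, -, hχ⟩ := (SmoothBumpFunction.nhds_basis_tsupport (I := 𝓘(ℝ, E)) y).mem_iff.1
    (hU.mem_nhds hy)
  refine ⟨fun x => χ x * h x, ?_, ?_⟩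
  · refine contMDiff_of_tsupport fun x hx => ?_
    have hx' : x ∈ tsupport χ := tsupport_mul_subset_left hx
    exact (χ.contMDiff.of_le (by simp)).contMDiffAt.mul (hh.contMDiffAt (hU.mem_nhds (hχ hx')))
  · filter_upwards [χ.eventuallyEq_one] with x hx
    simp [hx]

section Hermitian

variable [RiemannianBundle (fun y : N => TangentSpace 𝓘(ℝ, E) y)] [FiniteDimensional ℂ E]

theorem inner_riemannianGradient (v : N → ℝ) (y : N) (ξ : TangentSpace 𝓘(ℝ, E) y) :
    inner ℝ (riemannianGradient E v y) ξ = mfderiv 𝓘(ℝ, E) 𝓘(ℝ, ℝ) v y ξ := by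
  have : FiniteDimensional ℝ (TangentSpace 𝓘(ℝ, E) y) := FiniteDimensional.complexToReal E
  have : CompleteSpace (TangentSpace 𝓘(ℝ, E) y) := FiniteDimensional.complete ℝ _
  exact InnerProductSpace.toDual_symm_apply

theorem riemannianGradient_congr {v w : N → ℝ} {y : N} (h : v =ᶠ[𝓝 y] w) :
    riemannianGradient E v y = riemannianGradient E w y := by
  unfold riemannianGradient
  rw [h.mfderiv_eq]

theorem inner_riemannianGradient_comp {v : N → ℂ} {y : N} {L : E →L[ℂ] ℂ}
    (h : HasMFDerivAt 𝓘(ℂ, E) 𝓘(ℂ, ℂ) v y L) {f : ℂ → ℝ} (hf : DifferentiableAt ℝ f (v y))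
    (ξ : TangentSpace 𝓘(ℝ, E) y) :
    inner ℝ (riemannianGradient E (fun x => f (v x)) y) ξ = fderiv ℝ f (v y) (L ξ) := by
  have h1 : HasMFDerivAt 𝓘(ℝ, ℂ) 𝓘(ℝ, ℝ) f (v y) (fderiv ℝ f (v y)) :=
    hf.hasFDerivAt.hasMFDerivAt
  have h2 := (h1.comp y h.restrictScalars_real).mfderiv
  exact (inner_riemannianGradient _ y ξ).trans (DFunLike.congr_fun h2 ξ)

theorem inner_riemannianGradient_re {v : N → ℂ} {y : N} {L : E →L[ℂ] ℂ}
    (h : HasMFDerivAt 𝓘(ℂ, E) 𝓘(ℂ, ℂ) v y L) (ξ : TangentSpace 𝓘(ℝ, E) y) :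
    inner ℝ (riemannianGradient E (fun x => (v x).re) y) ξ = (L ξ).re :=
  (inner_riemannianGradient_comp h Complex.reCLM.differentiableAt ξ).trans
    (by rw [ContinuousLinearMap.fderiv]; rfl)

theorem inner_riemannianGradient_im {v : N → ℂ} {y : N} {L : E →L[ℂ] ℂ}
    (h : HasMFDerivAt 𝓘(ℂ, E) 𝓘(ℂ, ℂ) v y L) (ξ : TangentSpace 𝓘(ℝ, E) y) :
    inner ℝ (riemannianGradient E (fun x => (v x).im) y) ξ = (L ξ).im :=
  (inner_riemannianGradient_comp h Complex.imCLM.differentiableAt ξ).trans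
    (by rw [ContinuousLinearMap.fderiv]; rfl)

omit [RiemannianBundle (fun y : N => TangentSpace 𝓘(ℝ, E) y)] [FiniteDimensional ℂ E] in
theorem complexStructure_complexStructure (y : N) (ξ : TangentSpace 𝓘(ℝ, E) y) :
    complexStructure y (complexStructure y ξ) = -ξ := by
  change (Complex.I • (Complex.I • (show E from ξ)) : E) = -(show E from ξ)
  rw [smul_smul, Complex.I_mul_I, neg_one_smul]

/-- The Cauchy–Riemann equations: `∇(Im v) = J ∇(Re v)` for a holomorphic function `v`. -/
theorem riemannianGradient_im (hN : IsHermitianMetric E N) {v : N → ℂ} {y : N}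
    (hv : MDifferentiableAt 𝓘(ℂ, E) 𝓘(ℂ, ℂ) v y) :
    riemannianGradient E (fun x => (v x).im) y =
      complexStructure y (riemannianGradient E (fun x => (v x).re) y) := by
  obtain ⟨L, hL⟩ : ∃ L : E →L[ℂ] ℂ, HasMFDerivAt 𝓘(ℂ, E) 𝓘(ℂ, ℂ) v y L := ⟨_, hv.hasMFDerivAt⟩
  refine ext_inner_right ℝ fun ξ => ?_
  rw [← hN y (complexStructure y _) ξ, complexStructure_complexStructure, inner_neg_left,
    inner_riemannianGradient_im hL, inner_riemannianGradient_re hL]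
  have h : L (complexStructure y ξ) = Complex.I • L ξ := L.map_smul Complex.I ξ
  rw [h]
  simp

theorem inner_riemannianGradient_im_im (hN : IsHermitianMetric E N) {v w : N → ℂ} {y : N}
    (hv : MDifferentiableAt 𝓘(ℂ, E) 𝓘(ℂ, ℂ) v y) (hw : MDifferentiableAt 𝓘(ℂ, E) 𝓘(ℂ, ℂ) w y) :
    inner ℝ (riemannianGradient E (fun x => (v x).im) y)
        (riemannianGradient E (fun x => (w x).im) y) =
      inner ℝ (riemannianGradient E (fun x => (v x).re) y)
        (riemannianGradient E (fun x => (w x).re) y) := by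
  rw [riemannianGradient_im hN hv, riemannianGradient_im hN hw, hN]

theorem inner_riemannianGradient_im_re (hN : IsHermitianMetric E N) {v w : N → ℂ} {y : N}
    (hv : MDifferentiableAt 𝓘(ℂ, E) 𝓘(ℂ, ℂ) v y) (hw : MDifferentiableAt 𝓘(ℂ, E) 𝓘(ℂ, ℂ) w y) :
    inner ℝ (riemannianGradient E (fun x => (v x).im) y)
        (riemannianGradient E (fun x => (w x).re) y) =
      -inner ℝ (riemannianGradient E (fun x => (v x).re) y)
        (riemannianGradient E (fun x => (w x).im) y) := by
  rw [riemannianGradient_im hN hv, riemannianGradient_im hN hw, ← hN,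
    complexStructure_complexStructure, inner_neg_left]

/-- The gradient of a real function of a holomorphic function. -/
theorem riemannianGradient_comp_holomorphic {z : N → ℂ} {y : N}
    (hz : MDifferentiableAt 𝓘(ℂ, E) 𝓘(ℂ, ℂ) z y) {f : ℂ → ℝ} (hf : DifferentiableAt ℝ f (z y)) :
    riemannianGradient E (fun x => f (z x)) y =
      fderiv ℝ f (z y) 1 • riemannianGradient E (fun x => (z x).re) y +
        fderiv ℝ f (z y) Complex.I • riemannianGradient E (fun x => (z x).im) y := by
  obtain ⟨L, hL⟩ : ∃ L : E →L[ℂ] ℂ, HasMFDerivAt 𝓘(ℂ, E) 𝓘(ℂ, ℂ) z y L := ⟨_, hz.hasMFDerivAt⟩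
  refine ext_inner_right ℝ fun ξ => ?_
  rw [inner_add_left, real_inner_smul_left, real_inner_smul_left,
    inner_riemannianGradient_comp hL hf, inner_riemannianGradient_re hL,
    inner_riemannianGradient_im hL]
  have h : L ξ = (L ξ).re • (1 : ℂ) + (L ξ).im • Complex.I := by simp
  calc fderiv ℝ f (z y) (L ξ)
      = fderiv ℝ f (z y) ((L ξ).re • (1 : ℂ) + (L ξ).im • Complex.I) := congrArg _ h
    _ = _ := by
      rw [map_add, map_smul, map_smul, smul_eq_mul, smul_eq_mul]
      ring

theorem riemannianGradient_re_ne_zero [IsManifold 𝓘(ℂ, E) ω N] [Nontrivial E] (y₀ : N)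
    (ℓ : E ≃L[ℂ] ℂ) {y : N} (hy : y ∈ (chartAt E y₀).source) :
    riemannianGradient E (fun x => (ℓ (chartAt E y₀ x)).re) y ≠ 0 := by
  have : IsManifold 𝓘(ℂ, E) 1 N := IsManifold.of_le (n := ω) (by simp)
  have hc := mdifferentiable_chart (I := 𝓘(ℂ, E)) y₀
  obtain ⟨ξ, hξ⟩ := hc.mfderiv_surjective hy (ℓ.symm (1 : ℂ))
  have h1 := (hc.mdifferentiableAt hy).hasMFDerivAt
  have h2 : HasMFDerivAt 𝓘(ℂ, E) 𝓘(ℂ, ℂ) ℓ (chartAt E y₀ y) (ℓ : E →L[ℂ] ℂ) :=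
    (ℓ.hasFDerivAt).hasMFDerivAt
  have h3 := h2.comp y h1
  intro h0
  have h4 : inner ℝ (riemannianGradient E (fun x => (ℓ (chartAt E y₀ x)).re) y)
      (show TangentSpace 𝓘(ℝ, E) y from ξ) = (ℓ (ℓ.symm (1 : ℂ))).re :=
    (inner_riemannianGradient_re (v := fun x => ℓ (chartAt E y₀ x)) h3 ξ).trans
      (congrArg (fun η : E => (ℓ η).re) hξ)
  rw [h0, inner_zero_left] at h4
  simp at h4

end Hermitian

end Holomorphic

/-! ### The open maximal simplexes of a polyhedron -/

namespace LipTriangulation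

variable {X : Type*} [MetricSpace X] {m : ℕ} (T : LipTriangulation X m)

theorem isOpen_openCell (Δ : T.Cell) : IsOpen (T.openCell Δ) := isOpen_interior

theorem frame_mem_convexHull {Δ : T.Cell} {s : EuclideanSpace ℝ (Fin m)} (hs : s ∈ T.openCell Δ) :
    T.frame Δ s ∈ convexHull ℝ (Δ.1 : Set (EuclideanSpace ℝ (Fin T.ambientDim))) :=
  interior_subset (s := T.frame Δ ⁻¹' _) hs

theorem frame_mem_space {Δ : T.Cell} {s : EuclideanSpace ℝ (Fin m)} (hs : s ∈ T.openCell Δ) :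
    T.frame Δ s ∈ T.K.space :=
  T.K.convexHull_subset_space Δ.2.1 (T.frame_mem_convexHull hs)

theorem point_of_mem [Nonempty X] {Δ : T.Cell} {s : EuclideanSpace ℝ (Fin m)}
    (hs : s ∈ T.openCell Δ) : T.point Δ s = T.θ ⟨T.frame Δ s, T.frame_mem_space hs⟩ :=
  dif_pos (T.frame_mem_space hs)

theorem continuousOn_point [Nonempty X] (Δ : T.Cell) :
    ContinuousOn (T.point Δ) (T.openCell Δ) := by
  rw [continuousOn_iff_continuous_domRestrict]
  have h : (T.openCell Δ).domRestrict (T.point Δ) =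
      fun s : T.openCell Δ => T.θ ⟨T.frame Δ s, T.frame_mem_space s.2⟩ := by
    funext s
    exact T.point_of_mem s.2
  rw [h]
  exact T.θ.continuous.comp
    (((T.frame Δ).continuous.comp continuous_subtype_val).subtype_mk _)

theorem isOpen_openCell_inter [Nonempty X] (Δ : T.Cell) {Ω : Set X} (hΩ : IsOpen Ω) :
    IsOpen (T.openCell Δ ∩ T.point Δ ⁻¹' Ω) :=
  (T.continuousOn_point Δ).isOpen_inter_preimage (T.isOpen_openCell Δ) hΩ

/-- A point of the open simplex `Δ` lies on no proper face of `Δ`: its barycentric coordinates are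
positive. -/
theorem frame_notMem_convexHull {Δ : T.Cell} {s : EuclideanSpace ℝ (Fin m)}
    (hs : s ∈ T.openCell Δ) {F : Set (EuclideanSpace ℝ (Fin T.ambientDim))} (hF : F ⊂ Δ.1) :
    T.frame Δ s ∉ convexHull ℝ F := by
  obtain ⟨hFΔ, v, hv, hvF⟩ := (ssubset_iff_exists).1 hF
  have hinj : Function.Injective (T.frame Δ) := (T.frame Δ).injective
  -- the vertices of `Δ`, in the coordinates of the frame
  have hpre : ∀ i : Δ.1, ∃ p, T.frame Δ p = i := fun i => by
    have : (i : EuclideanSpace ℝ (Fin T.ambientDim)) ∈ Set.range (T.frame Δ) := by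
      rw [T.range_frame Δ]
      exact subset_affineSpan ℝ _ i.2
    exact this
  choose b hb using hpre
  have hind : AffineIndependent ℝ b := by
    have h := T.K.indep Δ.2.1
    refine AffineIndependent.of_comp (T.frame Δ).toAffineMap ?_
    have hcomp : (T.frame Δ).toAffineMap ∘ b = ((↑) : Δ.1 → _) := funext hb
    rw [hcomp]
    exact h
  have htop : affineSpan ℝ (range b) = ⊤ := by
    rw [hind.affineSpan_eq_top_iff_card_eq_finrank_add_one]
    simp [Δ.2.2]
  let B : AffineBasis Δ.1 ℝ (EuclideanSpace ℝ (Fin m)) := ⟨b, hind, htop⟩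
  have hB : ⇑B = b := rfl
  have himage : T.frame Δ '' (range b) = Δ.1 := by
    ext x
    constructor
    · rintro ⟨_, ⟨i, rfl⟩, rfl⟩
      rw [hb]
      exact i.2
    · intro hx
      exact ⟨b ⟨x, hx⟩, ⟨_, rfl⟩, hb _⟩
  have hhull : T.frame Δ ⁻¹' convexHull ℝ (Δ.1 : Set (EuclideanSpace ℝ (Fin T.ambientDim))) =
      convexHull ℝ (range b) := by
    have := (T.frame Δ).toAffineMap.image_convexHull (range b)
    change T.frame Δ '' _ = convexHull ℝ (T.frame Δ '' _) at this
    rw [← himage, ← this, preimage_image_eq _ hinj]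
  have hpos : 0 < B.coord ⟨v, hv⟩ s := by
    have h1 : s ∈ interior (convexHull ℝ (range B)) := by
      rw [hB, ← hhull]
      exact hs
    rw [B.interior_convexHull] at h1
    exact h1 _
  intro hmem
  have hF' : T.frame Δ '' (b '' {i | (i : EuclideanSpace ℝ (Fin T.ambientDim)) ∈ F}) = F := by
    ext x
    constructor
    · rintro ⟨_, ⟨i, hi, rfl⟩, rfl⟩
      rw [hb]
      exact hi
    · intro hx
      exact ⟨b ⟨x, hFΔ hx⟩, ⟨_, hx, rfl⟩, hb _⟩
  have hs' : s ∈ convexHull ℝ (b '' {i | (i : EuclideanSpace ℝ (Fin T.ambientDim)) ∈ F}) := by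
    have := (T.frame Δ).toAffineMap.image_convexHull
      (b '' {i | (i : EuclideanSpace ℝ (Fin T.ambientDim)) ∈ F})
    change T.frame Δ '' _ = convexHull ℝ (T.frame Δ '' _) at this
    rw [hF'] at this
    rw [← this] at hmem
    exact hinj.mem_set_image.1 hmem
  have hzero : convexHull ℝ (b '' {i | (i : EuclideanSpace ℝ (Fin T.ambientDim)) ∈ F}) ⊆
      B.coord ⟨v, hv⟩ ⁻¹' {0} := by
    refine convexHull_min ?_ ((convex_singleton 0).affine_preimage _)
    rintro _ ⟨i, hi, rfl⟩
    have hne : (⟨v, hv⟩ : Δ.1) ≠ i := by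
      rintro rfl
      exact hvF hi
    exact B.coord_apply_ne hne
  exact hpos.ne' (hzero hs')

/-- The open maximal simplexes are disjoint, and each of them is embedded in `X`. -/
theorem eq_of_point_eq [Nonempty X] {Δ Δ' : T.Cell} {s s' : EuclideanSpace ℝ (Fin m)}
    (hs : s ∈ T.openCell Δ) (hs' : s' ∈ T.openCell Δ') (h : T.point Δ s = T.point Δ' s') :
    Δ = Δ' ∧ s = s' := by
  rw [T.point_of_mem hs, T.point_of_mem hs', T.θ.injective.eq_iff, Subtype.mk.injEq] at h
  have hΔ : Δ = Δ' := by
    have hmem : T.frame Δ s ∈ convexHull ℝ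
        ((Δ.1 : Set (EuclideanSpace ℝ (Fin T.ambientDim))) ∩ Δ'.1) :=
      T.K.inter_subset_convexHull Δ.2.1 Δ'.2.1
        ⟨T.frame_mem_convexHull hs, h ▸ T.frame_mem_convexHull hs'⟩
    by_contra hne
    refine T.frame_notMem_convexHull hs (LE.le.ssubset_of_ne inter_subset_left ?_) hmem
    intro heq
    have hsub : Δ.1 ⊆ Δ'.1 := by
      rw [← Finset.coe_subset]
      exact inter_eq_left.1 heq
    exact hne (Subtype.ext (Finset.eq_of_subset_of_card_le hsub (by rw [Δ.2.2, Δ'.2.2])))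
  subst hΔ
  exact ⟨rfl, (T.frame Δ).injective h⟩

theorem almostEverywhere_iff [Nonempty X] {p : T.Cell → EuclideanSpace ℝ (Fin m) → Prop} :
    T.AlmostEverywhere p ↔ ∀ Δ, ∀ᵐ s, s ∈ T.openCell Δ → p Δ s :=
  forall_congr' fun Δ => ae_restrict_iff' (T.isOpen_openCell Δ).measurableSet

end LipTriangulation

namespace RiemannianPolyhedron

variable {X : Type*} [MetricSpace X] {m : ℕ} (P : RiemannianPolyhedron X m)

theorem gradInner_add_smul (Δ : P.Cell) (s a b : EuclideanSpace ℝ (Fin m)) (p q p' q' : ℝ) :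
    P.gradInner Δ s (p • a + q • b) (p' • a + q' • b) =
      p * p' * P.gradInner Δ s a a + p * q' * P.gradInner Δ s a b +
        q * p' * P.gradInner Δ s b a + q * q' * P.gradInner Δ s b b := by
  simp only [gradInner, PiLp.add_apply, PiLp.smul_apply, smul_eq_mul, Finset.mul_sum,
    ← Finset.sum_add_distrib]
  refine Finset.sum_congr rfl fun i _ => Finset.sum_congr rfl fun j _ => ?_
  ring

theorem gradInner_comm {Δ : P.Cell} {s : EuclideanSpace ℝ (Fin m)} (h : (P.g Δ s).PosDef)
    (a b : EuclideanSpace ℝ (Fin m)) : P.gradInner Δ s a b = P.gradInner Δ s b a := by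
  have hsymm : ∀ i j, (P.g Δ s)⁻¹ i j = (P.g Δ s)⁻¹ j i := fun i j => by
    simpa using h.isHermitian.inv.apply j i
  unfold gradInner
  rw [Finset.sum_comm]
  refine Finset.sum_congr rfl fun i _ => Finset.sum_congr rfl fun j _ => ?_
  rw [hsymm]
  ring

end RiemannianPolyhedron

/-! ### Horizontally weakly conformal maps -/

namespace RiemannianPolyhedron

variable {X : Type*} [MetricSpace X] [MeasurableSpace X] [Nonempty X] {m : ℕ}
  {P : RiemannianPolyhedron X m}
  {E : Type*} [NormedAddCommGroup E] [NormedSpace ℂ E] [FiniteDimensional ℂ E]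
  {N : Type*} [TopologicalSpace N] [ChartedSpace E N]
  [RiemannianBundle (fun y : N => TangentSpace 𝓘(ℝ, E) y)] {φ : X → N}

/-- The gradients of the functions that are `C¹` on an open set `U` exist on `φ⁻¹(U)`, by
localization from the gradients of functions on all of `N`. -/
theorem HorizontallyWeaklyConformal.exists_isWeakGradient [T2Space N] [IsManifold 𝓘(ℂ, E) ω N]
    (h : P.HorizontallyWeaklyConformal E φ) {U : Set N} (hU : IsOpen U) {v : N → ℝ}
    (hv : ContMDiffOn 𝓘(ℝ, E) 𝓘(ℝ, ℝ) 1 v U) :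
    ∃ G, P.IsWeakGradient (fun x => v (φ x)) (φ ⁻¹' U) G := by
  have : FiniteDimensional ℝ E := FiniteDimensional.complexToReal E
  obtain ⟨hc, -, lam, hlam⟩ := h
  suffices ∀ Δ, ∃ G, HasWeakGradientOn (fun s => v (φ (P.point Δ s))) G
      (P.openCell Δ ∩ P.point Δ ⁻¹' (φ ⁻¹' U)) by
    choose G hG using this
    exact ⟨G, hG⟩
  intro Δ
  refine HasWeakGradientOn.exists_of_local
    (P.isOpen_openCell_inter Δ (hU.preimage hc)) fun s hs => ?_
  obtain ⟨v', hv', hvv'⟩ := hv.exists_contMDiff_eventuallyEq hU hs.2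
  obtain ⟨V, hV, hVo, hyV⟩ := eventually_nhds_iff.1 hvv'
  obtain ⟨G, -, hG, -, -⟩ := hlam v' v' hv' hv'
  have hO := P.isOpen_openCell_inter Δ (hVo.preimage hc)
  exact ⟨_, hO, ⟨hs.1, hyV⟩, G Δ, HasWeakGradientOn.congr hO
    (HasWeakGradientOn.mono (hG Δ) (inter_subset_inter_right _ (subset_univ _)))
    (fun x hx => hV _ hx.2) (.of_forall fun _ _ => rfl)⟩

/-- The defining equation of horizontal weak conformality holds for functions that are only defined
and `C¹` on an open set. -/
theorem HorizontallyWeaklyConformal.exists_gradInner_eq [T2Space N] [IsManifold 𝓘(ℂ, E) ω N]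
    (h : P.HorizontallyWeaklyConformal E φ) :
    ∃ lam : X → ℝ, ∀ {U : Set N} {v w : N → ℝ}
      {Gv Gw : P.Cell → EuclideanSpace ℝ (Fin m) → EuclideanSpace ℝ (Fin m)}, IsOpen U →
      ContMDiffOn 𝓘(ℝ, E) 𝓘(ℝ, ℝ) 1 v U → ContMDiffOn 𝓘(ℝ, E) 𝓘(ℝ, ℝ) 1 w U →
      P.IsWeakGradient (fun x => v (φ x)) (φ ⁻¹' U) Gv →
      P.IsWeakGradient (fun x => w (φ x)) (φ ⁻¹' U) Gw →
      ∀ Δ, ∀ᵐ s, s ∈ P.openCell Δ ∩ P.point Δ ⁻¹' (φ ⁻¹' U) →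
        P.gradInner Δ s (Gv Δ s) (Gw Δ s) = lam (P.point Δ s) *
          inner ℝ (riemannianGradient E v (φ (P.point Δ s)))
            (riemannianGradient E w (φ (P.point Δ s))) := by
  have : FiniteDimensional ℝ E := FiniteDimensional.complexToReal E
  obtain ⟨hc, -, lam, hlam⟩ := h
  refine ⟨lam, fun {U v w Gv Gw} hU hv hw hGv hGw Δ => ae_of_forall_exists_isOpen fun s hs => ?_⟩
  obtain ⟨v', hv', hvv'⟩ := hv.exists_contMDiff_eventuallyEq hU hs.2
  obtain ⟨w', hw', hww'⟩ := hw.exists_contMDiff_eventuallyEq hU hs.2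
  obtain ⟨V, hV, hVo, hyV⟩ := eventually_nhds_iff.1 (hvv'.and (hww'.and (hU.mem_nhds hs.2)))
  obtain ⟨Gv', Gw', hGv', hGw', heq⟩ := hlam v' w' hv' hw'
  have hO := P.isOpen_openCell_inter Δ (hVo.preimage hc)
  have hsub : P.openCell Δ ∩ P.point Δ ⁻¹' (φ ⁻¹' V) ⊆
      P.openCell Δ ∩ P.point Δ ⁻¹' (φ ⁻¹' U) := fun x hx => ⟨hx.1, (hV _ hx.2).2.2⟩
  have huniv : P.openCell Δ ∩ P.point Δ ⁻¹' (φ ⁻¹' V) ⊆ P.openCell Δ ∩ P.point Δ ⁻¹' univ :=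
    inter_subset_inter_right _ (subset_univ _)
  refine ⟨_, hO, ⟨hs.1, hyV⟩, ?_⟩
  have e1 := HasWeakGradientOn.ae_eq hO
    (HasWeakGradientOn.congr hO (HasWeakGradientOn.mono (hGv' Δ) huniv)
      (fun x hx => (hV _ hx.2).1) (.of_forall fun _ _ => rfl))
    (HasWeakGradientOn.mono (hGv Δ) hsub)
  have e2 := HasWeakGradientOn.ae_eq hO
    (HasWeakGradientOn.congr hO (HasWeakGradientOn.mono (hGw' Δ) huniv)
      (fun x hx => (hV _ hx.2).2.1) (.of_forall fun _ _ => rfl))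
    (HasWeakGradientOn.mono (hGw Δ) hsub)
  filter_upwards [e1, e2, P.almostEverywhere_iff.1 heq Δ] with x h1 h2 h3 hx
  have hVx : V ∈ 𝓝 (φ (P.point Δ x)) := hVo.mem_nhds hx.2
  have g1 : v' =ᶠ[𝓝 (φ (P.point Δ x))] v := by
    filter_upwards [hVx] with y hy using (hV y hy).1
  have g2 : w' =ᶠ[𝓝 (φ (P.point Δ x))] w := by
    filter_upwards [hVx] with y hy using (hV y hy).2.1
  rw [← h1 hx, ← h2 hx, h3 hx.1, riemannianGradient_congr g1, riemannianGradient_congr g2]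

theorem HorizontallyWeaklyConformal.pseudoHorizontallyWeaklyConformal [T2Space N]
    [IsManifold 𝓘(ℂ, E) ω N] (hN : IsHermitianMetric E N)
    (h : P.HorizontallyWeaklyConformal E φ) : P.PseudoHorizontallyWeaklyConformal E φ := by
  refine ⟨h.1, h.2.1, fun U v w hU hv hw => ?_⟩
  have re : ∀ {f : N → ℂ}, MDifferentiableOn 𝓘(ℂ, E) 𝓘(ℂ, ℂ) f U →
      ContMDiffOn 𝓘(ℝ, E) 𝓘(ℝ, ℝ) 1 (fun y => (f y).re) U := fun hf =>
    Complex.reCLM.contDiff.contMDiff.comp_contMDiffOn (hf.contMDiffOn_one_real hU)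
  have im : ∀ {f : N → ℂ}, MDifferentiableOn 𝓘(ℂ, E) 𝓘(ℂ, ℂ) f U →
      ContMDiffOn 𝓘(ℝ, E) 𝓘(ℝ, ℝ) 1 (fun y => (f y).im) U := fun hf =>
    Complex.imCLM.contDiff.contMDiff.comp_contMDiffOn (hf.contMDiffOn_one_real hU)
  obtain ⟨Gv₁, hv₁⟩ := h.exists_isWeakGradient hU (re hv)
  obtain ⟨Gv₂, hv₂⟩ := h.exists_isWeakGradient hU (im hv)
  obtain ⟨Gw₁, hw₁⟩ := h.exists_isWeakGradient hU (re hw)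
  obtain ⟨Gw₂, hw₂⟩ := h.exists_isWeakGradient hU (im hw)
  refine ⟨Gv₁, Gv₂, Gw₁, Gw₂, hv₁, hv₂, hw₁, hw₂, P.almostEverywhere_iff.2 fun Δ => ?_⟩
  obtain ⟨lam, hlam⟩ := h.exists_gradInner_eq
  filter_upwards [hlam hU (re hw) (re hv) hw₁ hv₁ Δ, hlam hU (im hw) (im hv) hw₂ hv₂ Δ,
    hlam hU (im hw) (re hv) hw₂ hv₁ Δ, hlam hU (re hw) (im hv) hw₁ hv₂ Δ] with s h1 h2 h3 h4 hs hsU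
  have hvs := hv.mdifferentiableAt (hU.mem_nhds hsU)
  have hws := hw.mdifferentiableAt (hU.mem_nhds hsU)
  rw [h1 ⟨hs, hsU⟩, h2 ⟨hs, hsU⟩, h3 ⟨hs, hsU⟩, h4 ⟨hs, hsU⟩,
    inner_riemannianGradient_im_im hN hws hvs, inner_riemannianGradient_im_re hN hws hvs]
  constructor <;> ring

end RiemannianPolyhedron

/-! ### Targets of complex dimension one -/

namespace RiemannianPolyhedron

variable {X : Type*} [MetricSpace X] [MeasurableSpace X] [Nonempty X] {m : ℕ}
  {P : RiemannianPolyhedron X m}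
  {E : Type*} [NormedAddCommGroup E] [NormedSpace ℂ E] [FiniteDimensional ℂ E]
  {N : Type*} [TopologicalSpace N] [ChartedSpace E N]
  [RiemannianBundle (fun y : N => TangentSpace 𝓘(ℝ, E) y)] {φ : X → N}

omit [MeasurableSpace X] [FiniteDimensional ℂ E]
  [RiemannianBundle (fun y : N => TangentSpace 𝓘(ℝ, E) y)] in
/-- The chain rule in a one-dimensional complex chart `z = ℓ ∘ chartAt E y₀`: the gradients of
`Re z ∘ φ` and `Im z ∘ φ` determine the gradient of `v ∘ φ`. -/
theorem hasWeakGradientOn_comp_chart [IsManifold 𝓘(ℂ, E) ω N] (hc : Continuous φ)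
    (ℓ : E ≃L[ℂ] ℂ) {y₀ : N}
    {A B : P.Cell → EuclideanSpace ℝ (Fin m) → EuclideanSpace ℝ (Fin m)}
    (hA : P.IsWeakGradient (fun x => (ℓ (chartAt E y₀ (φ x))).re) (φ ⁻¹' (chartAt E y₀).source) A)
    (hB : P.IsWeakGradient (fun x => (ℓ (chartAt E y₀ (φ x))).im) (φ ⁻¹' (chartAt E y₀).source) B)
    {v : N → ℝ} (hv : ContMDiff 𝓘(ℝ, E) 𝓘(ℝ, ℝ) 1 v) :
    ∃ f : ℂ → ℝ, (∀ y ∈ (chartAt E y₀).source, DifferentiableAt ℝ f (ℓ (chartAt E y₀ y)) ∧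
        v =ᶠ[𝓝 y] fun x => f (ℓ (chartAt E y₀ x))) ∧
      ∀ Δ, HasWeakGradientOn (fun s => v (φ (P.point Δ s)))
        (fun s => fderiv ℝ f (ℓ (chartAt E y₀ (φ (P.point Δ s)))) 1 • A Δ s +
          fderiv ℝ f (ℓ (chartAt E y₀ (φ (P.point Δ s)))) Complex.I • B Δ s)
        (P.openCell Δ ∩ P.point Δ ⁻¹' (φ ⁻¹' (chartAt E y₀).source)) := by
  set c := chartAt E y₀ with hcdef
  have hsrc : ∀ y ∈ c.source, ℓ (c y) ∈ ℓ.symm ⁻¹' c.target := fun y hy => by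
    simpa using c.map_source hy
  have hW : IsOpen (ℓ.symm ⁻¹' c.target) := c.open_target.preimage ℓ.symm.continuous
  let f : ℂ → ℝ := fun z => v (c.symm (ℓ.symm z))
  have hf : ContDiffOn ℝ 1 f (ℓ.symm ⁻¹' c.target) := by
    have h1 : ContMDiffOn 𝓘(ℝ, E) 𝓘(ℝ, E) 1 c.symm c.target := by
      have : IsManifold 𝓘(ℝ, E) 1 N := IsManifold.of_le (n := ∞) (by simp)
      exact contMDiffOn_chart_symm
    have h2 : ContDiffOn ℝ 1 (v ∘ c.symm) c.target :=
      (hv.comp_contMDiffOn h1).contDiffOn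
    have h3 : ContDiff ℝ 1 (ℓ.symm : ℂ → E) := (ℓ.symm.contDiff (n := 1)).restrict_scalars ℝ
    exact h2.comp h3.contDiffOn fun z hz => hz
  have hfv : ∀ y ∈ c.source, v y = f (ℓ (c y)) := fun y hy => by
    simp [f, c.left_inv hy]
  refine ⟨f, fun y hy => ⟨?_, ?_⟩, fun Δ => ?_⟩
  · exact (hf.contDiffAt (hW.mem_nhds (hsrc y hy))).differentiableAt one_ne_zero
  · filter_upwards [c.open_source.mem_nhds hy] with x hx using hfv x hx
  · have hO := P.isOpen_openCell_inter Δ (c.open_source.preimage hc)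
    have hu : ContinuousOn (fun s => ℓ (c (φ (P.point Δ s))))
        (P.openCell Δ ∩ P.point Δ ⁻¹' (φ ⁻¹' c.source)) :=
      ℓ.continuous.comp_continuousOn (c.continuousOn.comp
        (hc.comp_continuousOn ((P.continuousOn_point Δ).mono inter_subset_left)) fun s hs => hs.2)
    exact (HasWeakGradientOn.comp_contDiffOn hO hu (hA Δ) (hB Δ) hW hf
      fun s hs => hsrc _ hs.2).congr hO (fun s hs => (hfv _ hs.2).symm)
      (.of_forall fun _ _ => rfl)

/-- On a target of complex dimension one, a holomorphic coordinate `z` has gradients `∇(Re z ∘ φ)`,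
`∇(Im z ∘ φ)` that are orthogonal and of the same length, as are `∇(Re z)`, `∇(Im z)` on the
target, so that every other function is compared through the chain rule. The dilation is the
quotient of the squared lengths. -/
theorem PseudoHorizontallyWeaklyConformal.horizontallyWeaklyConformal
    [SecondCountableTopology N] [IsManifold 𝓘(ℂ, E) ω N] (hN : IsHermitianMetric E N)
    (hE : Module.finrank ℂ E = 1) (h : P.PseudoHorizontallyWeaklyConformal E φ) :
    P.HorizontallyWeaklyConformal E φ := by
  classical
  obtain ⟨hc, hW12, hph⟩ := h
  have : IsManifold 𝓘(ℂ, E) 1 N := IsManifold.of_le (n := ω) (by simp)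
  have : Nontrivial E := Module.nontrivial_of_finrank_pos (R := ℂ) (by omega)
  let ℓ : E ≃L[ℂ] ℂ := ContinuousLinearEquiv.ofFinrankEq (by simp [hE])
  -- the holomorphic coordinate of the chart at `y`
  let z : N → N → ℂ := fun y x => ℓ (chartAt E y x)
  have hz : ∀ y, MDifferentiableOn 𝓘(ℂ, E) 𝓘(ℂ, ℂ) (z y) (chartAt E y).source := fun y =>
    ℓ.differentiable.mdifferentiable.comp_mdifferentiableOn
      (mdifferentiableOn_atlas (chart_mem_atlas E y))
  have hso : ∀ y : N, IsOpen (chartAt E y).source := fun y => (chartAt E y).open_source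
  have hAB : ∀ y, ∃ A B, P.IsWeakGradient (fun x => (z y (φ x)).re)
      (φ ⁻¹' (chartAt E y).source) A ∧ P.IsWeakGradient (fun x => (z y (φ x)).im)
      (φ ⁻¹' (chartAt E y).source) B ∧
      ∀ Δ, ∀ᵐ s, s ∈ P.openCell Δ ∩ P.point Δ ⁻¹' (φ ⁻¹' (chartAt E y).source) →
        P.gradInner Δ s (B Δ s) (B Δ s) = P.gradInner Δ s (A Δ s) (A Δ s) ∧
        P.gradInner Δ s (A Δ s) (B Δ s) = 0 ∧ P.gradInner Δ s (B Δ s) (A Δ s) = 0 := by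
    intro y
    obtain ⟨A, B, A', B', hA, hB, hA', hB', heq⟩ := hph _ _ _ (hso y) (hz y) (hz y)
    refine ⟨A, B, hA, hB, fun Δ => ?_⟩
    have hO := P.isOpen_openCell_inter Δ ((hso y).preimage hc)
    filter_upwards [P.almostEverywhere_iff.1 heq Δ, HasWeakGradientOn.ae_eq hO (hA Δ) (hA' Δ),
      HasWeakGradientOn.ae_eq hO (hB Δ) (hB' Δ),
      (ae_restrict_iff' (P.isOpen_openCell Δ).measurableSet).1 (P.posDef_g Δ)]
      with s h1 h2 h3 h4 hs
    obtain ⟨q1, q2⟩ := h1 hs.1 hs.2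
    rw [← h2 hs, ← h3 hs] at q1 q2
    have q3 := P.gradInner_comm (h4 hs.1) (A Δ s) (B Δ s)
    refine ⟨?_, ?_, ?_⟩ <;> linarith
  choose A B hA hB hconf using hAB
  -- countably many charts cover the target
  obtain ⟨t, htc, hcov⟩ := TopologicalSpace.countable_cover_nhds
    fun y : N => (hso y).mem_nhds (mem_chart_source E y)
  have hcov' : ∀ y : N, ∃ y₀ ∈ t, y ∈ (chartAt E y₀).source := fun y => by
    have : y ∈ ⋃ x ∈ t, (chartAt E x).source := hcov ▸ mem_univ y
    simpa using this
  choose c hct hcs using hcov'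
  let dil : P.Cell → EuclideanSpace ℝ (Fin m) → ℝ := fun Δ s =>
    P.gradInner Δ s (A (c (φ (P.point Δ s))) Δ s) (A (c (φ (P.point Δ s))) Δ s) /
      inner ℝ (riemannianGradient E (fun x => (z (c (φ (P.point Δ s))) x).re) (φ (P.point Δ s)))
        (riemannianGradient E (fun x => (z (c (φ (P.point Δ s))) x).re) (φ (P.point Δ s)))
  -- the dilation as a function on `X`: the open simplexes are disjoint
  obtain ⟨lam, hlam⟩ : ∃ lam : X → ℝ, ∀ Δ, ∀ s ∈ P.openCell Δ, lam (P.point Δ s) = dil Δ s := by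
    refine ⟨fun x => if hx : ∃ p : P.Cell × EuclideanSpace ℝ (Fin m),
      p.2 ∈ P.openCell p.1 ∧ P.point p.1 p.2 = x then dil hx.choose.1 hx.choose.2 else 0,
      fun Δ s hs => ?_⟩
    have hx : ∃ p : P.Cell × EuclideanSpace ℝ (Fin m),
      p.2 ∈ P.openCell p.1 ∧ P.point p.1 p.2 = P.point Δ s := ⟨(Δ, s), hs, rfl⟩
    simp only [dif_pos hx]
    obtain ⟨e1, e2⟩ := P.eq_of_point_eq hx.choose_spec.1 hs hx.choose_spec.2
    rw [e1, e2]
  refine ⟨hc, hW12, lam, fun v w hv hw => ?_⟩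
  have hex : ∀ {v : N → ℝ}, ContMDiff 𝓘(ℝ, E) 𝓘(ℝ, ℝ) 1 v →
      ∃ G, P.IsWeakGradient (v ∘ φ) univ G := by
    intro v hv
    suffices ∀ Δ, ∃ G, HasWeakGradientOn (fun s => v (φ (P.point Δ s))) G
        (P.openCell Δ ∩ P.point Δ ⁻¹' univ) by
      choose G hG using this
      exact ⟨G, hG⟩
    intro Δ
    refine HasWeakGradientOn.exists_of_local (P.isOpen_openCell_inter Δ isOpen_univ)
      fun s hs => ?_
    obtain ⟨f, -, hf⟩ := hasWeakGradientOn_comp_chart hc ℓ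
      (hA (φ (P.point Δ s))) (hB (φ (P.point Δ s))) hv
    exact ⟨_, P.isOpen_openCell_inter Δ ((hso _).preimage hc),
      ⟨hs.1, mem_chart_source E (φ (P.point Δ s))⟩, _, hf Δ⟩
  obtain ⟨Gv, hGv⟩ := hex hv
  obtain ⟨Gw, hGw⟩ := hex hw
  refine ⟨Gv, Gw, hGv, hGw, P.almostEverywhere_iff.2 fun Δ => ?_⟩
  have key : ∀ᵐ s, ∀ y ∈ t, s ∈ P.openCell Δ ∩ P.point Δ ⁻¹' (φ ⁻¹' (chartAt E y).source) →
      P.gradInner Δ s (Gv Δ s) (Gw Δ s) =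
        P.gradInner Δ s (A y Δ s) (A y Δ s) /
          inner ℝ (riemannianGradient E (fun x => (z y x).re) (φ (P.point Δ s)))
            (riemannianGradient E (fun x => (z y x).re) (φ (P.point Δ s))) *
        inner ℝ (riemannianGradient E v (φ (P.point Δ s)))
          (riemannianGradient E w (φ (P.point Δ s))) := by
    refine (ae_ball_iff htc).2 fun y _ => ?_
    obtain ⟨f, hf, hfG⟩ := hasWeakGradientOn_comp_chart hc ℓ (hA y) (hB y) hv
    obtain ⟨k, hk, hkG⟩ := hasWeakGradientOn_comp_chart hc ℓ (hA y) (hB y) hw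
    have hO := P.isOpen_openCell_inter Δ ((hso y).preimage hc)
    have hsub : P.openCell Δ ∩ P.point Δ ⁻¹' (φ ⁻¹' (chartAt E y).source) ⊆
        P.openCell Δ ∩ P.point Δ ⁻¹' univ := inter_subset_inter_right _ (subset_univ _)
    filter_upwards [hconf y Δ,
      HasWeakGradientOn.ae_eq hO (HasWeakGradientOn.mono (hGv Δ) hsub) (hfG Δ),
      HasWeakGradientOn.ae_eq hO (HasWeakGradientOn.mono (hGw Δ) hsub) (hkG Δ)] with s h1 h2 h3 hs
    obtain ⟨q1, q2, q3⟩ := h1 hs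
    obtain ⟨f1, f2⟩ := hf _ hs.2
    obtain ⟨k1, k2⟩ := hk _ hs.2
    have hzd := (hz y).mdifferentiableAt ((hso y).mem_nhds hs.2)
    rw [h2 hs, h3 hs, P.gradInner_add_smul, q1, q2, q3, riemannianGradient_congr f2,
      riemannianGradient_congr k2, riemannianGradient_comp_holomorphic hzd f1,
      riemannianGradient_comp_holomorphic hzd k1]
    have r1 := inner_riemannianGradient_im_im hN hzd hzd
    have r2 := inner_riemannianGradient_im_re hN hzd hzd
    have r3 : inner ℝ (riemannianGradient E (fun x => (z y x).re) (φ (P.point Δ s)))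
        (riemannianGradient E (fun x => (z y x).re) (φ (P.point Δ s))) ≠ 0 :=
      inner_self_ne_zero.2 (riemannianGradient_re_ne_zero y ℓ hs.2)
    rw [real_inner_comm] at r2
    have r4 := self_eq_neg.1 r2
    have r5 := r4
    rw [real_inner_comm] at r5
    simp only [inner_add_left, inner_add_right, real_inner_smul_left, real_inner_smul_right]
    rw [r1, r4, r5]
    field_simp
    ring
  filter_upwards [key] with s hs hsΔ
  rw [hlam Δ s hsΔ]
  exact hs _ (hct _) ⟨hsΔ, hcs _⟩

end RiemannianPolyhedron

theorem proposition3p4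
    {X : Type*} [MetricSpace X] [ConnectedSpace X] [LocallyCompactSpace X]
    [TopologicalSpace.SeparableSpace X] [MeasurableSpace X] [BorelSpace X]
    {m : ℕ} (P : RiemannianPolyhedron X m) (hP : P.IsAdmissible)
    {E : Type*} [NormedAddCommGroup E] [NormedSpace ℂ E] [FiniteDimensional ℂ E]
    {N : Type*} [TopologicalSpace N] [T2Space N] [SecondCountableTopology N]
    [ChartedSpace E N] [IsManifold 𝓘(ℂ, E) ω N]
    [RiemannianBundle (fun y : N => TangentSpace 𝓘(ℝ, E) y)]
    [IsContMDiffRiemannianBundle 𝓘(ℝ, E) ∞ E (fun y : N => TangentSpace 𝓘(ℝ, E) y)]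
    (hN : IsHermitianMetric E N)
    (φ : X → N) :
    (P.HorizontallyWeaklyConformal E φ → P.PseudoHorizontallyWeaklyConformal E φ) ∧
    (Module.finrank ℂ E = 1 →
      (P.HorizontallyWeaklyConformal E φ ↔ P.PseudoHorizontallyWeaklyConformal E φ)) := by
  exact ⟨fun h => h.pseudoHorizontallyWeaklyConformal hN, fun hE =>
    ⟨fun h => h.pseudoHorizontallyWeaklyConformal hN, fun h => h.horizontallyWeaklyConformal hN hE⟩⟩
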